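/- **Model.** Time is slotted, $t=0,1,2,\dots$. There are $N$ sensor nodes sending to a base station. The channel states $M(t)$ are i.i.d. on a finite set $\mathbf M$ with $\pi_k=\Pr(M(t)=k)$; the arrival vectors $R(t)=(R_n(t))_n$ are i.i.d., nonnegative and bounded, with mean $\lambda=(\lambda_n)_n$, and are independent of the channel. The two modes of a node are sleep ($0$, also $s$) and active ($1$, also $a$). In slot $t$, after $M(t)=k$ is observed, at most one node, which must be active, transmits; a transmitting node $n$ has rate $\mu_n(t)=(\mu_n)_k\ge 0$, and $\mu_n(t)=0$ for the other nodes. The node's mode in slot $t+1$ is also chosen during slot $t$. The queues satisfy $Q_n(t+1)=\max(Q_n(t)-\mu_n(t),0)+R_n(t)$; initial modes and initial backlogs $Q_n(0)\ge0$ are arbitrary but fixed. In slot $t$ node $n$ spends $e_0^n$ if asleep and $c^n+\mu_n(t)\alpha_n$ if active, plus $e_{01}^n$ (resp. $e_{10}^n$) if it switches from sleep to active (resp. from active to sleep) between slots $t$ and $t+1$; all these constants are $\ge 0$. $H(t)$ is the total energy spent in slot $t$ and $\overline H=\limsup_{T\to\infty}\frac1T\sum_{\tau<T}\mathbb E[H(\tau)]$.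 The network is stable if $\limsup_{T\to\infty}\frac1T\sum_{\tau<T}\mathbb E[Q_n(\tau)]<\infty$ for all $n$. The capacity region $\Lambda$ is the closure of the convex hull of the set of arrival rate vectors for which some causal (possibly randomized and history-dependent) policy stabilizes the network. A *stationary randomized policy* is given by transition probabilities $(p^n_{ij})_k$ ($i,j\in\{0,1\}$) and transmission probabilities $(\pi^n_{tr})_k\ge 0$ with $\sum_{n\in Ac}(\pi_{tr}^n)_k\le1$ for each set $Ac$ of nodes. In a slot with channel state $k$, at most one node is selected, node $n$ with probability $(\pi^n_{tr})_k$, independently of everything else in the past and of the modes, and the selected node transmits if it is active; each node $n$ in mode $i$ independently moves to mode $j$ with probability $(p^n_{ij})_k$. Let $h^*$ be the minimum (infimum) of $\overline H$ over the stationary randomized policies that stabilize the network. **Theorem 1.** Suppose that $\lambda$ is strictly inside the capacity region, i.e. $\lambda+(\delta,\dots,\delta)\in\Lambda$ for some $\delta>0$. Then $h^*$ is well defined (the set of energies is non-empty and bounded below) and equals the optimal value, which is attained, of the problem, in the variables $(p_{ij}^n)_k$, $(\pi_l^n)_k$ ($l\in\{a,s\}$) and $(\pi^n_{tr})_k$,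 $$\min\ \sum_{k}\pi_k\sum_n\Big[(p^n_{10})_k(\pi^n_a)_k e^n_{10}+(p^n_{01})_k(\pi^n_s)_k e^n_{01}+(\pi_s^n)_k e_0^n+(\pi_a^n)_k\big(c^n+(\pi^n_{tr})_k(\mu_n)_k\alpha_n\big)\Big]$$ $$\text{s.t.}\quad \sum_k\pi_k(\pi^n_a)_k(\pi^n_{tr})_k(\mu_n)_k\ge\lambda_n\ \ \forall n,\qquad \sum_{n\in Ac}(\pi^n_{tr})_k\le1\ \ \forall k,\ \forall Ac\subseteq\{1,\dots,N\},$$ where the $(p^n_{ij})_k$ are transition probabilities, $(\pi^n_{tr})_k\ge 0$, and the $(\pi^n_l)_k\ge0$ are steady-state mode probabilities at channel state $k$: $(\pi_a^n)_k+(\pi_s^n)_k=1$, and $\pi_k(\pi_l^n)_k$ is a stationary distribution of the Markov chain formed by the channel state and the mode of node $n$. Moreover, if $h^*(\epsilon)$ denotes the minimum energy for arrivals with mean $\lambda+\epsilon$, $\epsilon\in[0,\infty)^N$, then $h^*(\epsilon)\to h^*$ as $\epsilon\to0$, whatever the (bounded) arrival laws with these means are. -/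

import Mathlib

open MeasureTheory ProbabilityTheory Filter Topology

noncomputable section

namespace SensorNet

/-- Static data of an uplink network with `N` nodes and finite set `K` of channel states.
Modes are booleans throughout: `false` is sleep (state 0), `true` is active (state 1). -/
structure Network (N : ℕ) (K : Type) where
  /-- the law of the network channel state in a slot -/
  chan : PMF K
  /-- `rate n k`: data rate (packets per slot) of node `n` when it transmits in channel state `k` -/
  rate : Fin N → K → ℝ
  rate_nonneg : ∀ n k, 0 ≤ rate n k
  /-- energy per slot in sleep mode -/
  e0 : Fin N → ℝ
  e0_nonneg : ∀ n, 0 ≤ e0 n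
  /-- circuit energy per slot in active mode -/
  c : Fin N → ℝ
  c_nonneg : ∀ n, 0 ≤ c n
  /-- energy per transmitted packet -/
  α : Fin N → ℝ
  α_nonneg : ∀ n, 0 ≤ α n
  /-- energy of switching from sleep to active -/
  e01 : Fin N → ℝ
  e01_nonneg : ∀ n, 0 ≤ e01 n
  /-- energy of switching from active to sleep -/
  e10 : Fin N → ℝ
  e10_nonneg : ∀ n, 0 ≤ e10 n
  /-- modes in slot `0` -/
  initMode : Fin N → Bool
  /-- backlogs in slot `0` -/
  initQueue : Fin N → ℝ
  initQueue_nonneg : ∀ n, 0 ≤ initQueue n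

/-- The law of the vector of arrivals in one slot: nonnegative and bounded. -/
structure Arrival (N : ℕ) where
  law : Measure (Fin N → ℝ)
  isProb : IsProbabilityMeasure law
  Rmax : ℝ
  bounded : ∀ᵐ r ∂law, ∀ n, 0 ≤ r n ∧ r n ≤ Rmax

instance {N : ℕ} (A : Arrival N) : IsProbabilityMeasure A.law := A.isProb

/-- The vector `λ` of average arrival rates. -/
def Arrival.mean {N : ℕ} (A : Arrival N) (n : Fin N) : ℝ := ∫ r, r n ∂A.law

/-- What happens in one slot: channel state, arrivals, and the private randomness of the
controller (one uniform coin for each node and one uniform coin for the scheduler). -/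
abbrev Slot (N : ℕ) (K : Type) : Type :=
  K × (Fin N → ℝ) × (Fin N → unitInterval) × unitInterval

/-- Sample paths. -/
abbrev Path (N : ℕ) (K : Type) : Type := ℕ → Slot N K

section Model

variable {N : ℕ} {K : Type} [Fintype K] [MeasurableSpace K] [MeasurableSingletonClass K]

/-- Law of one slot: channel, arrivals and coins are independent. -/
def slotLaw (net : Network N K) (A : Arrival N) : Measure (Slot N K) :=
  net.chan.toMeasure.prod
    (A.law.prod ((Measure.pi fun _ : Fin N => (volume : Measure unitInterval)).prod volume))

instance (net : Network N K) (A : Arrival N) : IsProbabilityMeasure (slotLaw net A) := by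
  unfold slotLaw; infer_instance

/-- Law of the sample path: the slots are i.i.d. -/
def pathLaw (net : Network N K) (A : Arrival N) : Measure (Path N K) :=
  Measure.infinitePi fun _ : ℕ => slotLaw net A

/-- A feasible (causal, possibly randomized and history dependent) control policy.
`mode t ω n` is the mode of node `n` in slot `t`, decided by the end of slot `t - 1`;
`tx t ω n` is the indicator `I_n(t)` that `n` transmits in slot `t`, decided after
the channel state of slot `t` is observed. At most one node transmits in a slot,
and only an active node can transmit. -/
structure Policy (net : Network N K) where
  mode : ℕ → Path N K → Fin N → Bool
  tx : ℕ → Path N K → Fin N → Bool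
  measurable_mode : ∀ t n, Measurable fun ω => mode t ω n
  measurable_tx : ∀ t n, Measurable fun ω => tx t ω n
  mode_zero : ∀ ω, mode 0 ω = net.initMode
  mode_causal : ∀ t ω ω', (∀ τ < t, ω τ = ω' τ) → mode t ω = mode t ω'
  tx_causal : ∀ t ω ω', (∀ τ < t, ω τ = ω' τ) → (ω t).1 = (ω' t).1 →
    (ω t).2.2 = (ω' t).2.2 → tx t ω = tx t ω'
  tx_active : ∀ t ω n, tx t ω n = true → mode t ω n = true
  tx_unique : ∀ t ω n m, tx t ω n = true → tx t ω m = true → n = m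

namespace Policy

variable {net : Network N K}

/-- The transmission rate `μ_n(t)`. -/
def service (P : Policy net) (t : ℕ) (ω : Path N K) (n : Fin N) : ℝ :=
  if P.tx t ω n then net.rate n (ω t).1 else 0

/-- The backlog `Q_n(t)`, with `Q_n(t+1) = max (Q_n(t) - μ_n(t)) 0 + R_n(t)`. -/
def queue (P : Policy net) : ℕ → Path N K → Fin N → ℝ
  | 0, _, n => net.initQueue n
  | t + 1, ω, n => max (P.queue t ω n - P.service t ω n) 0 + (ω t).2.1 n

/-- Switching energy of a change from the first to the second mode. -/
def switchEnergy (net : Network N K) (n : Fin N) : Bool → Bool → ℝ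
  | false, true => net.e01 n
  | true, false => net.e10 n
  | _, _ => 0

/-- The total energy `H(t)` spent in slot `t`; the switch to the mode of slot `t + 1`
is carried out, and paid for, in slot `t`. -/
def energy (P : Policy net) (t : ℕ) (ω : Path N K) : ℝ :=
  ∑ n, ((if P.mode t ω n then net.c n + P.service t ω n * net.α n else net.e0 n)
    + switchEnergy net n (P.mode t ω n) (P.mode (t + 1) ω n))

/-- The time average expected total energy consumption. -/
def avgEnergy (P : Policy net) (A : Arrival N) : ℝ :=
  limsup (fun T : ℕ =>
    (1 / (T : ℝ)) * ∑ τ ∈ Finset.range T, ∫ ω, P.energy τ ω ∂(pathLaw net A)) atTop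

/-- Strong stability of every queue. -/
def Stable (P : Policy net) (A : Arrival N) : Prop :=
  ∀ n, limsup (fun T : ℕ =>
    (∑ τ ∈ Finset.range T, ∫⁻ ω, ENNReal.ofReal (P.queue τ ω n) ∂(pathLaw net A))
      / (T : ENNReal)) atTop < ⊤

end Policy

/-- The capacity region: closure of the convex hull of the arrival rate vectors for which
some feasible policy stabilizes the network. -/
def capacityRegion (net : Network N K) : Set (Fin N → ℝ) :=
  closure (convexHull ℝ
    {r | ∃ A : Arrival N, A.mean = r ∧ ∃ P : Policy net, P.Stable A})

end Model

/-- `p n k i j`: probability that node `n` in mode `i` moves to mode `j` when the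
channel state is `k`. -/
def IsSwitching {N : ℕ} {K : Type} (p : Fin N → K → Bool → Bool → ℝ) : Prop :=
  (∀ n k i j, 0 ≤ p n k i j) ∧ ∀ n k i, p n k i false + p n k i true = 1

/-- `tr n k`: probability that node `n` is selected for transmission when the channel state
is `k`; whatever the set `Ac` of active nodes is, at most one of them is selected. -/
def IsTransmission {N : ℕ} {K : Type} (tr : Fin N → K → ℝ) : Prop :=
  (∀ n k, 0 ≤ tr n k) ∧ ∀ k (Ac : Finset (Fin N)), ∑ n ∈ Ac, tr n k ≤ 1

/-- Parameters of a stationary randomized (RND) policy. -/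
structure RND (N : ℕ) (K : Type) where
  p : Fin N → K → Bool → Bool → ℝ
  tr : Fin N → K → ℝ
  isSwitching : IsSwitching p
  isTransmission : IsTransmission tr

namespace RND

variable {N : ℕ} {K : Type}

/-- In slot `t` with channel state `k`, node `n` in mode `i` is active in slot `t + 1` iff its
coin is below `p n k i true`. -/
def mode (θ : RND N K) (s₀ : Fin N → Bool) : ℕ → Path N K → Fin N → Bool
  | 0, _, n => s₀ n
  | t + 1, ω, n => decide (((ω t).2.2.1 n : ℝ) < θ.p n (ω t).1 (θ.mode s₀ t ω n) true)

/-- Node `n` is selected in channel state `k` iff the scheduling coin `w` falls into the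
`n`-th of consecutive disjoint intervals of lengths `tr 0 k, tr 1 k, …`. -/
def sel (θ : RND N K) (k : K) (w : unitInterval) (n : Fin N) : Prop :=
  ∑ m ∈ Finset.Iio n, θ.tr m k ≤ (w : ℝ) ∧ (w : ℝ) < ∑ m ∈ Finset.Iic n, θ.tr m k

open Classical in
/-- The selected node transmits if it is active. -/
def tx (θ : RND N K) (s₀ : Fin N → Bool) (t : ℕ) (ω : Path N K) (n : Fin N) : Bool :=
  θ.mode s₀ t ω n && decide (θ.sel (ω t).1 (ω t).2.2.2 n)

theorem sel_unique (θ : RND N K) (k : K) (w : unitInterval) (n m : Fin N)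
    (hn : θ.sel k w n) (hm : θ.sel k w m) : n = m := by
  have key : ∀ a b : Fin N, θ.sel k w a → θ.sel k w b → ¬ a < b := by
    intro a b ha hb hab
    have : ∑ j ∈ Finset.Iic a, θ.tr j k ≤ ∑ j ∈ Finset.Iio b, θ.tr j k := by
      apply Finset.sum_le_sum_of_subset_of_nonneg
      · intro j hj
        simp only [Finset.mem_Iic, Finset.mem_Iio] at hj ⊢
        exact lt_of_le_of_lt hj hab
      · intro j _ _
        exact θ.isTransmission.1 j k
    exact absurd (lt_of_lt_of_le ha.2 (this.trans hb.1)) (lt_irrefl _)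
  rcases lt_trichotomy n m with h | h | h
  · exact absurd h (key n m hn hm)
  · exact h
  · exact absurd h (key m n hm hn)

theorem mode_causal (θ : RND N K) (s₀ : Fin N → Bool) (t : ℕ) (ω ω' : Path N K)
    (h : ∀ τ < t, ω τ = ω' τ) : θ.mode s₀ t ω = θ.mode s₀ t ω' := by
  induction t with
  | zero => rfl
  | succ t ih =>
    have h1 := ih fun τ hτ => h τ (hτ.trans t.lt_succ_self)
    have h2 := h t t.lt_succ_self
    funext n
    simp only [mode, h1, h2]

variable [Fintype K] [MeasurableSpace K] [MeasurableSingletonClass K]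

theorem measurable_mode (θ : RND N K) (s₀ : Fin N → Bool) (t : ℕ) (n : Fin N) :
    Measurable fun ω => θ.mode s₀ t ω n := by
  induction t with
  | zero => exact measurable_const
  | succ t ih =>
    have hp : Measurable fun x : K × Bool => θ.p n x.1 x.2 true := measurable_of_finite _
    have hk : Measurable fun ω : Path N K => ((ω t).1, θ.mode s₀ t ω n) :=
      ((measurable_pi_apply t).fst).prodMk ih
    have hu : Measurable fun ω : Path N K => (((ω t).2.2.1 n : unitInterval) : ℝ) :=
      measurable_subtype_coe.comp
        ((measurable_pi_apply n).comp (measurable_pi_apply t).snd.snd.fst)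
    refine measurable_to_bool ?_
    have : (fun ω : Path N K => θ.mode s₀ (t + 1) ω n) ⁻¹' {true}
        = {ω | (((ω t).2.2.1 n : unitInterval) : ℝ)
            < θ.p n (ω t).1 (θ.mode s₀ t ω n) true} := by
      ext ω; simp [mode]
    rw [this]
    exact measurableSet_lt hu (hp.comp hk)

theorem measurable_tx (θ : RND N K) (s₀ : Fin N → Bool) (t : ℕ) (n : Fin N) :
    Measurable fun ω => θ.tx s₀ t ω n := by
  have hk : Measurable fun ω : Path N K => (ω t).1 := (measurable_pi_apply t).fst
  have hw : Measurable fun ω : Path N K => (((ω t).2.2.2 : unitInterval) : ℝ) :=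
    measurable_subtype_coe.comp (measurable_pi_apply t).snd.snd.snd
  have h1 : Measurable fun k : K => ∑ m ∈ Finset.Iio n, θ.tr m k := measurable_of_finite _
  have h2 : Measurable fun k : K => ∑ m ∈ Finset.Iic n, θ.tr m k := measurable_of_finite _
  refine measurable_to_bool ?_
  have : (fun ω : Path N K => θ.tx s₀ t ω n) ⁻¹' {true}
      = {ω | θ.mode s₀ t ω n = true} ∩
        ({ω | ∑ m ∈ Finset.Iio n, θ.tr m (ω t).1 ≤ (((ω t).2.2.2 : unitInterval) : ℝ)} ∩
          {ω | (((ω t).2.2.2 : unitInterval) : ℝ) < ∑ m ∈ Finset.Iic n, θ.tr m (ω t).1}) := by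
    ext ω
    simp only [tx, Set.mem_preimage, Set.mem_singleton_iff, Bool.and_eq_true,
      decide_eq_true_eq, Set.mem_inter_iff, Set.mem_ofPred_eq]
    exact Iff.rfl
  rw [this]
  exact ((θ.measurable_mode s₀ t n) (measurableSet_singleton true)).inter
    ((measurableSet_le (h1.comp hk) hw).inter (measurableSet_lt hw (h2.comp hk)))

/-- The stationary randomized policy with the given parameters. -/
def policy (θ : RND N K) (net : Network N K) : Policy net where
  mode := θ.mode net.initMode
  tx := θ.tx net.initMode
  measurable_mode := θ.measurable_mode net.initMode
  measurable_tx := θ.measurable_tx net.initMode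
  mode_zero := fun _ => rfl
  mode_causal := θ.mode_causal net.initMode
  tx_causal := by
    intro t ω ω' h hk hc
    funext n
    have hm := θ.mode_causal net.initMode t ω ω' h
    unfold tx
    rw [hm, hk, hc]
  tx_active := by
    intro t ω n h
    simp only [tx, Bool.and_eq_true] at h
    exact h.1
  tx_unique := by
    intro t ω n m hn hm
    simp only [tx, Bool.and_eq_true, decide_eq_true_eq] at hn hm
    exact θ.sel_unique _ _ n m hn.2 hm.2

end RND

section Optimization

variable {N : ℕ} {K : Type} [Fintype K] [MeasurableSpace K] [MeasurableSingletonClass K]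

/-- The average energies of the stationary randomized policies that stabilize the network. -/
def stabilizingEnergies (net : Network N K) (A : Arrival N) : Set ℝ :=
  {h | ∃ θ : RND N K, (θ.policy net).Stable A ∧ (θ.policy net).avgEnergy A = h}

/-- The minimum (infimal) energy `h*` with which a stationary randomized policy stabilizes
the network. -/
def minEnergy (net : Network N K) (A : Arrival N) : ℝ := sInf (stabilizingEnergies net A)

/-- The steady-state probability `π_k` of channel state `k`. -/
def chanProb (net : Network N K) (k : K) : ℝ := (net.chan k).toReal

/-- `st n k l` is a steady-state probability that node `n` is in mode `l` at channel state `k`: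
the probabilities `π_k * st n k l` form a stationary distribution of the Markov chain
(channel state, mode of `n`), which moves from `(j, i)` to `(k, l)` with probability
`p n j i l * π_k`. -/
def IsSteadyState (net : Network N K) (p : Fin N → K → Bool → Bool → ℝ)
    (st : Fin N → K → Bool → ℝ) : Prop :=
  (∀ n k l, 0 ≤ st n k l) ∧
  (∀ n k, st n k true + st n k false = 1) ∧
  ∀ n k l, chanProb net k * st n k l =
    ∑ j, ∑ i, chanProb net j * st n j i * (p n j i l * chanProb net k)

/-- Objective function of the optimization problem. -/
def objective (net : Network N K) (p : Fin N → K → Bool → Bool → ℝ)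
    (st : Fin N → K → Bool → ℝ) (tr : Fin N → K → ℝ) : ℝ :=
  ∑ k, chanProb net k * ∑ n,
    (p n k true false * st n k true * net.e10 n + p n k false true * st n k false * net.e01 n
      + st n k false * net.e0 n
      + st n k true * (net.c n + tr n k * net.rate n k * net.α n))

/-- Constraints of the optimization problem for the arrival rate vector `lam`. -/
def IsFeasible (net : Network N K) (lam : Fin N → ℝ) (p : Fin N → K → Bool → Bool → ℝ)
    (st : Fin N → K → Bool → ℝ) (tr : Fin N → K → ℝ) : Prop :=
  IsSwitching p ∧ IsSteadyState net p st ∧ IsTransmission tr ∧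
  ∀ n, lam n ≤ ∑ k, chanProb net k * st n k true * tr n k * net.rate n k

/-- The values of the objective function at the feasible points. -/
def feasibleValues (net : Network N K) (lam : Fin N → ℝ) : Set ℝ :=
  {v | ∃ p st tr, IsFeasible net lam p st tr ∧ objective net p st tr = v}

end Optimization

end SensorNet

end

set_option linter.unusedSectionVars false

/-! Everything reduces to a static problem: choose activity probabilities `σ n` and transmission
probabilities `tr` with `lam n ≤ σ n * offeredRate net tr n`, and minimize `baseEnergy`, which
ignores switching. Switching costs nothing in the infimum: slowing all mode chains by a factor `κ`
keeps their stationary law and multiplies the switching energy by `κ`. In the optimization problem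
`κ = 0` is itself allowed, because every `σ` is stationary for frozen modes, so the minimum is
attained there. A policy with frozen modes would keep its initial modes forever, so policies only
approach this value.

Lower bound (`RND.exists_stationary_of_stable`): the time-averaged activities of a stabilizing
policy lie in a compact cube. Along times at which the mean backlogs are bounded they have a limit
point; it satisfies the balance equations, covers the arrival rates, and costs at most the limsup
energy.

Upper bound (`IsStatic.exists_stabilizing`): a static point with strict slack, run with slow
switching, is stabilizing. Modes have memory, so service is not independent of the backlog;
`exists_sum_le_of_drift` corrects the quadratic Lyapunov function by the backlog-mode correlation.

Slack comes from the capacity region: by `capacityRegion_subset` it lies in the closure of the rates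
offered by transmission probabilities alone. Mixing a minimizer with a vector offering slack costs
arbitrarily little (`IsStatic.exists_slack`), which closes the gap between the bounds and also gives
continuity in the arrival rates. -/

namespace SensorNet

/-! ### Independence of the slots and expectations over a single slot. -/

section SlotLaw

variable {N : ℕ} {K : Type} [Fintype K] [MeasurableSpace K] [MeasurableSingletonClass K]

instance (net : Network N K) (A : Arrival N) : IsProbabilityMeasure (pathLaw net A) := by
  unfold pathLaw; infer_instance

theorem measurePreserving_eval_pathLaw (net : Network N K) (A : Arrival N) (t : ℕ) :
    MeasurePreserving (fun ω : Path N K => ω t) (pathLaw net A) (slotLaw net A) :=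
  measurePreserving_eval_infinitePi (fun _ : ℕ => slotLaw net A) t

theorem integral_eval_pathLaw (net : Network N K) (A : Arrival N) (t : ℕ) {g : Slot N K → ℝ}
    (hg : Measurable g) : ∫ ω, g (ω t) ∂(pathLaw net A) = ∫ s, g s ∂(slotLaw net A) := by
  rw [← (measurePreserving_eval_pathLaw net A t).map_eq,
    integral_map (measurable_pi_apply t).aemeasurable hg.aestronglyMeasurable]

/-- A random variable determined by the slots before `t` is independent of slot `t`. -/
theorem indepFun_eval_of_dependsOn (net : Network N K) (A : Arrival N) {t : ℕ}
    {X : Path N K → ℝ} (hX : Measurable X) (hdep : DependsOn X (Set.Iio t)) :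
    IndepFun X (fun ω => ω t) (pathLaw net A) := by
  obtain ⟨ω₀⟩ : Nonempty (Path N K) := (pathLaw net A).nonempty_of_neZero
  have hind : iIndepFun (fun (i : ℕ) (ω : Path N K) => ω i) (pathLaw net A) :=
    iIndepFun_infinitePi (P := fun _ : ℕ => slotLaw net A) (X := fun _ s => s)
      fun _ => measurable_id
  have hST : Disjoint (Finset.range t) {t} := by simp
  have h := hind.indepFun_finset (Finset.range t) {t} hST fun i => measurable_pi_apply i
  -- Extends a finite history to a full path by an arbitrary `ω₀`; the choice is immaterial because
  -- `X` only sees slots before `t`. This makes `X` a measurable function of finitely many slots.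
  let fill : (Finset.range t → Slot N K) → Path N K :=
    fun y τ => if hτ : τ ∈ Finset.range t then y ⟨τ, hτ⟩ else ω₀ τ
  have hfill : Measurable fill := by
    refine measurable_pi_lambda _ fun τ => ?_
    by_cases hτ : τ ∈ Finset.range t
    · simp only [fill, dif_pos hτ]
      exact measurable_pi_apply _
    · simp only [fill, dif_neg hτ]
      exact measurable_const
  have hc := h.comp (hX.comp hfill)
    (measurable_pi_apply (⟨t, by simp⟩ : ({t} : Finset ℕ)))
  have hXe : (X ∘ fill) ∘ (fun (a : Path N K) (i : Finset.range t) => a i) = X := by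
    funext ω
    refine hdep fun τ hτ => ?_
    have : τ ∈ Finset.range t := Finset.mem_range.2 hτ
    simp only [fill, dif_pos this]
  rw [hXe] at hc
  exact hc

theorem integral_mul_eval_of_dependsOn (net : Network N K) (A : Arrival N) {t : ℕ}
    {X : Path N K → ℝ} (hX : Measurable X) (hdep : DependsOn X (Set.Iio t))
    {g : Slot N K → ℝ} (hg : Measurable g) :
    ∫ ω, X ω * g (ω t) ∂(pathLaw net A)
      = (∫ ω, X ω ∂(pathLaw net A)) * ∫ s, g s ∂(slotLaw net A) := by
  have h := (indepFun_eval_of_dependsOn net A hX hdep).comp measurable_id hg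
  have h2 := h.integral_fun_mul_eq_mul_integral hX.aestronglyMeasurable
    (hg.comp (measurable_pi_apply t)).aestronglyMeasurable
  simp only [Function.comp_def, id] at h2
  rw [h2, integral_eval_pathLaw net A t hg]

theorem integral_slotLaw_arrival (net : Network N K) (A : Arrival N) (n : Fin N) :
    ∫ s, s.2.1 n ∂(slotLaw net A) = A.mean n := by
  have hmp : MeasurePreserving (fun s : Slot N K => s.2.1) (slotLaw net A) A.law :=
    measurePreserving_fst.comp measurePreserving_snd
  rw [Arrival.mean, ← hmp.map_eq, integral_map hmp.measurable.aemeasurable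
    (measurable_pi_apply n).aestronglyMeasurable]

theorem integral_chan_prod (net : Network N K) {f : K × unitInterval → ℝ} (hf : Measurable f)
    {C : ℝ} (hC : ∀ x, |f x| ≤ C) :
    ∫ x, f x ∂(net.chan.toMeasure.prod (volume : Measure unitInterval))
      = ∑ k, chanProb net k * ∫ u, f (k, u) := by
  rw [integral_prod _ (Integrable.of_bound hf.aestronglyMeasurable C
    (Eventually.of_forall hC)), PMF.integral_eq_sum]
  rfl

theorem integral_slotLaw_nodeCoin (net : Network N K) (A : Arrival N) (n : Fin N)
    {f : K × unitInterval → ℝ} (hf : Measurable f) {C : ℝ} (hC : ∀ x, |f x| ≤ C) :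
    ∫ s, f (s.1, s.2.2.1 n) ∂(slotLaw net A) = ∑ k, chanProb net k * ∫ u, f (k, u) := by
  have h1 : MeasurePreserving (fun r : (Fin N → ℝ) × (Fin N → unitInterval) × unitInterval =>
      r.2.1 n) (A.law.prod ((Measure.pi fun _ : Fin N => (volume : Measure unitInterval)).prod
        volume)) volume :=
    (measurePreserving_eval (fun _ : Fin N => (volume : Measure unitInterval)) n).comp
      (measurePreserving_fst.comp measurePreserving_snd)
  have hmp : MeasurePreserving (fun s : Slot N K => (s.1, s.2.2.1 n)) (slotLaw net A)
      (net.chan.toMeasure.prod volume) := (MeasurePreserving.id _).prod h1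
  rw [← integral_chan_prod net hf hC, ← hmp.map_eq, integral_map hmp.measurable.aemeasurable
    hf.aestronglyMeasurable]

theorem integral_slotLaw_schedulerCoin (net : Network N K) (A : Arrival N)
    {f : K × unitInterval → ℝ} (hf : Measurable f) {C : ℝ} (hC : ∀ x, |f x| ≤ C) :
    ∫ s, f (s.1, s.2.2.2) ∂(slotLaw net A) = ∑ k, chanProb net k * ∫ u, f (k, u) := by
  have h1 : MeasurePreserving (fun r : (Fin N → ℝ) × (Fin N → unitInterval) × unitInterval =>
      r.2.2) (A.law.prod ((Measure.pi fun _ : Fin N => (volume : Measure unitInterval)).prod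
        volume)) volume :=
    measurePreserving_snd.comp measurePreserving_snd
  have hmp : MeasurePreserving (fun s : Slot N K => (s.1, s.2.2.2)) (slotLaw net A)
      (net.chan.toMeasure.prod volume) := (MeasurePreserving.id _).prod h1
  rw [← integral_chan_prod net hf hC, ← hmp.map_eq, integral_map hmp.measurable.aemeasurable
    hf.aestronglyMeasurable]

theorem chanProb_nonneg (net : Network N K) (k : K) : 0 ≤ chanProb net k := ENNReal.toReal_nonneg

theorem sum_chanProb (net : Network N K) : ∑ k, chanProb net k = 1 := by
  have h := PMF.integral_eq_sum net.chan (fun _ => (1 : ℝ))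
  simpa [chanProb] using h.symm

theorem pathLaw_chan_real (net : Network N K) (A : Arrival N) (t : ℕ) (k : K) :
    (pathLaw net A).real {ω | (ω t).1 = k} = chanProb net k := by
  have hmp : MeasurePreserving (fun ω : Path N K => (ω t).1) (pathLaw net A)
      net.chan.toMeasure := measurePreserving_fst.comp (measurePreserving_eval_pathLaw net A t)
  have h := hmp.measure_preimage (measurableSet_singleton k).nullMeasurableSet
  rw [PMF.toMeasure_apply_singleton _ _ (measurableSet_singleton k)] at h
  rw [measureReal_def, chanProb, ← h]
  rfl

theorem ae_arrival_bounds (net : Network N K) (A : Arrival N) :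
    ∀ᵐ ω ∂(pathLaw net A), ∀ t n, 0 ≤ (ω t).2.1 n ∧ (ω t).2.1 n ≤ A.Rmax := by
  rw [ae_all_iff]
  intro t
  have hmp : MeasurePreserving (fun ω : Path N K => (ω t).2.1) (pathLaw net A) A.law :=
    (measurePreserving_fst.comp measurePreserving_snd).comp
      (measurePreserving_eval_pathLaw net A t)
  exact hmp.quasiMeasurePreserving.ae A.bounded

theorem Arrival.mean_nonneg (A : Arrival N) (n : Fin N) : 0 ≤ A.mean n :=
  integral_nonneg_of_ae (A.bounded.mono fun _ h => (h n).1)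

/-- The average rate offered to node `n`, while active, by the transmission probabilities. -/
noncomputable def offeredRate (net : Network N K) (tr : Fin N → K → ℝ) (n : Fin N) : ℝ :=
  ∑ k, chanProb net k * tr n k * net.rate n k

/-- The probability that node `n` moves from mode `i` to mode `j`, averaged over the channel. -/
noncomputable def meanSwitch (net : Network N K) (p : Fin N → K → Bool → Bool → ℝ) (n : Fin N)
    (i j : Bool) : ℝ :=
  ∑ k, chanProb net k * p n k i j

theorem IsSwitching.le_one {p : Fin N → K → Bool → Bool → ℝ} (hp : IsSwitching p)
    (n : Fin N) (k : K) (i j : Bool) : p n k i j ≤ 1 := by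
  have h := hp.2 n k i
  cases j
  · linarith [hp.1 n k i true]
  · linarith [hp.1 n k i false]

theorem IsTransmission.le_one {tr : Fin N → K → ℝ} (h : IsTransmission tr) (n : Fin N) (k : K) :
    tr n k ≤ 1 := by
  simpa using h.2 k {n}

theorem meanSwitch_add (net : Network N K) {p : Fin N → K → Bool → Bool → ℝ}
    (hp : IsSwitching p) (n : Fin N) (i : Bool) :
    meanSwitch net p n i false + meanSwitch net p n i true = 1 := by
  rw [meanSwitch, meanSwitch, ← Finset.sum_add_distrib, ← sum_chanProb net]
  refine Finset.sum_congr rfl fun k _ => ?_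
  rw [← mul_add, hp.2, mul_one]

theorem offeredRate_nonneg (net : Network N K) {tr : Fin N → K → ℝ} (h : ∀ n k, 0 ≤ tr n k)
    (n : Fin N) : 0 ≤ offeredRate net tr n :=
  Finset.sum_nonneg fun k _ =>
    mul_nonneg (mul_nonneg (chanProb_nonneg net k) (h n k)) (net.rate_nonneg n k)

namespace RND

/-- The indicator that the coin of node `n` sends it from mode `i` to the active mode. -/
noncomputable def wakes (θ : RND N K) (n : Fin N) (i : Bool) (s : Slot N K) : ℝ :=
  if (s.2.2.1 n : ℝ) < θ.p n s.1 i true then 1 else 0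

open Classical in
/-- The rate at which the scheduler lets node `n` transmit, if it is active. -/
noncomputable def offered (θ : RND N K) (net : Network N K) (n : Fin N) (s : Slot N K) : ℝ :=
  if θ.sel s.1 s.2.2.2 n then net.rate n s.1 else 0

theorem measurableSet_wakes (θ : RND N K) (n : Fin N) (i : Bool) :
    MeasurableSet {x : K × unitInterval | (x.2 : ℝ) < θ.p n x.1 i true} :=
  measurableSet_lt (measurable_subtype_coe.comp measurable_snd)
    ((measurable_of_finite fun k => θ.p n k i true).comp measurable_fst)

theorem measurableSet_sel (θ : RND N K) (n : Fin N) :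
    MeasurableSet {x : K × unitInterval | θ.sel x.1 x.2 n} :=
  (measurableSet_le
    ((measurable_of_finite fun k => ∑ m ∈ Finset.Iio n, θ.tr m k).comp measurable_fst)
    (measurable_subtype_coe.comp measurable_snd)).inter
  (measurableSet_lt (measurable_subtype_coe.comp measurable_snd)
    ((measurable_of_finite fun k => ∑ m ∈ Finset.Iic n, θ.tr m k).comp measurable_fst))

theorem measurable_wakes (θ : RND N K) (n : Fin N) (i : Bool) : Measurable (θ.wakes n i) := by
  have h : Measurable fun s : Slot N K => (s.1, s.2.2.1 n) :=
    measurable_fst.prodMk ((measurable_pi_apply n).comp measurable_snd.snd.fst)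
  exact Measurable.ite (h (θ.measurableSet_wakes n i)) measurable_const measurable_const

theorem measurable_offered (θ : RND N K) (net : Network N K) (n : Fin N) :
    Measurable (θ.offered net n) := by
  have h : Measurable fun s : Slot N K => (s.1, s.2.2.2) :=
    measurable_fst.prodMk measurable_snd.snd.snd
  exact Measurable.ite (h (θ.measurableSet_sel n))
    ((measurable_of_finite (net.rate n)).comp measurable_fst) measurable_const

theorem integral_wakes (θ : RND N K) (net : Network N K) (A : Arrival N) (n : Fin N) (i : Bool) :
    ∫ s, θ.wakes n i s ∂(slotLaw net A) = meanSwitch net θ.p n i true := by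
  classical
  have hf : Measurable fun x : K × unitInterval =>
      if (x.2 : ℝ) < θ.p n x.1 i true then (1 : ℝ) else 0 :=
    Measurable.ite (θ.measurableSet_wakes n i) measurable_const measurable_const
  have h := integral_slotLaw_nodeCoin net A n hf (C := 1)
    (fun x => by split_ifs <;> simp)
  refine h.trans (Finset.sum_congr rfl fun k _ => ?_)
  congr 1
  have h0 := θ.isSwitching.1 n k i true
  have h1 := θ.isSwitching.le_one n k i true
  have hind : (fun u : unitInterval => if (u : ℝ) < θ.p n k i true then (1 : ℝ) else 0)
      = (Set.Iio (⟨θ.p n k i true, h0, h1⟩ : unitInterval)).indicator fun _ => 1 := by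
    funext u
    simp only [Set.indicator_apply, Set.mem_Iio, ← Subtype.coe_lt_coe]
  rw [hind, integral_indicator_const _ measurableSet_Iio, measureReal_def,
    unitInterval.volume_Iio, ENNReal.toReal_ofReal h0, smul_eq_mul, mul_one]

theorem integral_offered (θ : RND N K) (net : Network N K) (A : Arrival N) (n : Fin N) :
    ∫ s, θ.offered net n s ∂(slotLaw net A) = offeredRate net θ.tr n := by
  classical
  have hf : Measurable fun x : K × unitInterval =>
      if θ.sel x.1 x.2 n then net.rate n x.1 else 0 :=
    Measurable.ite (θ.measurableSet_sel n)
      ((measurable_of_finite (net.rate n)).comp measurable_fst) measurable_const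
  have h := integral_slotLaw_schedulerCoin net A hf (C := ∑ k, net.rate n k) (fun x => by
    have h0 : net.rate n x.1 ≤ ∑ k, net.rate n k :=
      Finset.single_le_sum (fun k _ => net.rate_nonneg n k) (Finset.mem_univ _)
    split_ifs
    · rwa [abs_of_nonneg (net.rate_nonneg n _)]
    · rw [abs_zero]; exact (net.rate_nonneg n _).trans h0)
  refine Eq.trans ?_ (h.trans (Finset.sum_congr rfl fun k _ => ?_))
  · rfl
  rw [mul_assoc]
  congr 1
  have htr := θ.isTransmission.1
  have ha : 0 ≤ ∑ m ∈ Finset.Iio n, θ.tr m k := Finset.sum_nonneg fun m _ => htr m k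
  have hb : 0 ≤ ∑ m ∈ Finset.Iic n, θ.tr m k := Finset.sum_nonneg fun m _ => htr m k
  have hab : ∑ m ∈ Finset.Iic n, θ.tr m k = θ.tr n k + ∑ m ∈ Finset.Iio n, θ.tr m k := by
    rw [← Finset.Iio_insert, Finset.sum_insert (by simp)]
  have hind : (fun u : unitInterval => if θ.sel k u n then net.rate n k else 0)
      -- The subset constraint on `tr` keeps both partial sums at most 1, so the whole selection
      -- interval fits into the range of the coin.
      = (Set.Ico (⟨_, ha, θ.isTransmission.2 k _⟩ : unitInterval)
          ⟨_, hb, θ.isTransmission.2 k _⟩).indicator fun _ => net.rate n k := by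
    funext u
    simp only [Set.indicator_apply, Set.mem_Ico, sel, ← Subtype.coe_lt_coe, ← Subtype.coe_le_coe]
    congr
  rw [hind, integral_indicator_const _ measurableSet_Ico, measureReal_def,
    unitInterval.volume_Ico, smul_eq_mul]
  congr 1
  dsimp only
  rw [hab, add_sub_cancel_right, ENNReal.toReal_ofReal (htr n k)]

end RND

end SlotLaw

end SensorNet

/-! ### Backlogs of arbitrary policies and consequences of stability. -/

namespace SensorNet

/-- Otherwise `W` eventually exceeds `b + 1`, so its partial sums grow with slope at least `b + 1`
and overtake `b * T`. -/
theorem frequently_le_of_sum_le {W : ℕ → ℝ} (hW : ∀ t, 0 ≤ W t) {b : ℝ}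
    (h : ∀ᶠ T : ℕ in atTop, ∑ τ ∈ Finset.range T, W τ ≤ b * T) :
    ∃ᶠ T in atTop, W T ≤ b + 1 := by
  by_contra hc
  rw [not_frequently] at hc
  obtain ⟨T₀, hT₀⟩ := eventually_atTop.1 hc
  obtain ⟨T₁, hT₁⟩ := eventually_atTop.1 h
  have key : ∀ m : ℕ, m * (b + 1) ≤ ∑ τ ∈ Finset.range (T₀ + m), W τ := by
    intro m
    induction m with
    | zero => simpa using Finset.sum_nonneg fun t _ => hW t
    | succ m ih =>
      rw [← add_assoc, Finset.sum_range_succ]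
      have := not_le.1 (hT₀ (T₀ + m) (Nat.le_add_right _ _))
      push_cast
      linarith
  obtain ⟨m₀, hm₀⟩ := exists_nat_gt (b * T₀)
  have h1 := hT₁ (T₀ + max T₁ m₀) (by omega)
  have h2 := key (max T₁ m₀)
  have h3 : (m₀ : ℝ) ≤ (max T₁ m₀ : ℕ) := by exact_mod_cast le_max_right _ _
  push_cast at h1 h2 h3
  nlinarith

section Policies

variable {N : ℕ} {K : Type} [Fintype K] [MeasurableSpace K] [MeasurableSingletonClass K]

/-- A bound for all transmission rates. -/
noncomputable def rateBound (net : Network N K) : ℝ := ∑ n, ∑ k, net.rate n k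

theorem rate_le_rateBound (net : Network N K) (n : Fin N) (k : K) :
    net.rate n k ≤ rateBound net :=
  (Finset.single_le_sum (f := net.rate n) (fun k _ => net.rate_nonneg n k)
    (Finset.mem_univ k)).trans
  (Finset.single_le_sum (f := fun n => ∑ k, net.rate n k)
    (fun n _ => Finset.sum_nonneg fun k _ => net.rate_nonneg n k) (Finset.mem_univ n))

theorem rateBound_nonneg (net : Network N K) : 0 ≤ rateBound net :=
  Finset.sum_nonneg fun n _ => Finset.sum_nonneg fun k _ => net.rate_nonneg n k

namespace Policy

variable {net : Network N K} (P : Policy net) (A : Arrival N)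

theorem service_nonneg (t : ℕ) (ω : Path N K) (n : Fin N) : 0 ≤ P.service t ω n := by
  unfold service
  split_ifs
  · exact net.rate_nonneg _ _
  · exact le_rfl

theorem service_le (t : ℕ) (ω : Path N K) (n : Fin N) : P.service t ω n ≤ rateBound net := by
  unfold service
  split_ifs
  · exact rate_le_rateBound _ _ _
  · exact rateBound_nonneg net

theorem measurable_service (t : ℕ) (n : Fin N) : Measurable fun ω => P.service t ω n :=
  Measurable.ite (P.measurable_tx t n (measurableSet_singleton true))
    ((measurable_of_finite (net.rate n)).comp (measurable_pi_apply t).fst) measurable_const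

theorem measurable_queue (t : ℕ) (n : Fin N) : Measurable fun ω => P.queue t ω n := by
  induction t with
  | zero => exact measurable_const
  | succ t ih =>
    exact ((ih.sub (P.measurable_service t n)).max measurable_const).add
      ((measurable_pi_apply n).comp (measurable_pi_apply t).snd.fst)

theorem dependsOn_queue (t : ℕ) (n : Fin N) :
    DependsOn (fun ω => P.queue t ω n) (Set.Iio t) := by
  induction t with
  | zero => intro ω ω' _; rfl
  | succ t ih =>
    intro ω ω' h
    have h1 : P.queue t ω n = P.queue t ω' n :=
      ih fun τ (hτ : τ < t) => h τ (hτ.trans t.lt_succ_self)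
    have h2 : ω t = ω' t := h t t.lt_succ_self
    have h3 : P.tx t ω = P.tx t ω' :=
      P.tx_causal t ω ω' (fun τ hτ => h τ (hτ.trans t.lt_succ_self)) (by rw [h2]) (by rw [h2])
    simp only [queue, service, h1, h2, h3]

/-- The crude linear bound, from ignoring all service, serves to make every integral below finite.
-/
theorem ae_queue_bounds : ∀ᵐ ω ∂(pathLaw net A), ∀ t n,
    0 ≤ P.queue t ω n ∧ P.queue t ω n ≤ net.initQueue n + t * A.Rmax := by
  filter_upwards [ae_arrival_bounds net A] with ω hω t n
  induction t with
  | zero => simpa [queue] using net.initQueue_nonneg n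
  | succ t ih =>
    obtain ⟨h1, h2⟩ := hω t n
    have h3 := P.service_nonneg t ω n
    have h4 : max (P.queue t ω n - P.service t ω n) 0 ≤ P.queue t ω n :=
      max_le (by linarith) ih.1
    have h5 : 0 ≤ max (P.queue t ω n - P.service t ω n) 0 := le_max_right _ _
    simp only [queue]
    push_cast
    constructor <;> linarith

theorem integrable_queue (t : ℕ) (n : Fin N) :
    Integrable (fun ω => P.queue t ω n) (pathLaw net A) := by
  refine Integrable.of_bound (P.measurable_queue t n).aestronglyMeasurable
    (net.initQueue n + t * A.Rmax) ?_
  filter_upwards [P.ae_queue_bounds A] with ω hω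
  rw [Real.norm_of_nonneg (hω t n).1]
  exact (hω t n).2

theorem integrable_service (t : ℕ) (n : Fin N) :
    Integrable (fun ω => P.service t ω n) (pathLaw net A) := by
  refine Integrable.of_bound (P.measurable_service t n).aestronglyMeasurable
    (rateBound net) (Eventually.of_forall fun ω => ?_)
  rw [Real.norm_of_nonneg (P.service_nonneg t ω n)]
  exact P.service_le t ω n

theorem integrable_arrival (net : Network N K) (t : ℕ) (n : Fin N) :
    Integrable (fun ω : Path N K => (ω t).2.1 n) (pathLaw net A) := by
  have hm : Measurable fun ω : Path N K => (ω t).2.1 n :=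
    (measurable_pi_apply n).comp (measurable_pi_apply t).snd.fst
  refine Integrable.of_bound hm.aestronglyMeasurable A.Rmax ?_
  filter_upwards [ae_arrival_bounds net A] with ω hω
  rw [Real.norm_of_nonneg (hω t n).1]
  exact (hω t n).2

theorem integral_arrival (net : Network N K) (t : ℕ) (n : Fin N) :
    ∫ ω : Path N K, (ω t).2.1 n ∂(pathLaw net A) = A.mean n := by
  rw [integral_eval_pathLaw net A t (g := fun s => s.2.1 n)
    ((measurable_pi_apply n).comp measurable_snd.fst), integral_slotLaw_arrival]

theorem integral_queue_nonneg (t : ℕ) (n : Fin N) :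
    0 ≤ ∫ ω, P.queue t ω n ∂(pathLaw net A) :=
  integral_nonneg_of_ae ((P.ae_queue_bounds A).mono fun _ h => (h t n).1)

/-- Conservation of packets: discarding the positive part gives `Q (t + 1) ≥ Q t - μ t + R t`, which
is summed in expectation. -/
theorem mul_mean_le (T : ℕ) (n : Fin N) :
    T * A.mean n ≤ (∑ τ ∈ Finset.range T, ∫ ω, P.service τ ω n ∂(pathLaw net A))
      + ∫ ω, P.queue T ω n ∂(pathLaw net A) := by
  induction T with
  | zero => simpa using P.integral_queue_nonneg A 0 n
  | succ T ih =>
    rw [Finset.sum_range_succ]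
    have h : ∫ ω, (P.queue T ω n - P.service T ω n + (ω T).2.1 n) ∂(pathLaw net A)
        ≤ ∫ ω, P.queue (T + 1) ω n ∂(pathLaw net A) := by
      refine integral_mono (((P.integrable_queue A T n).sub (P.integrable_service A T n)).add
        (integrable_arrival A net T n)) (P.integrable_queue A (T + 1) n) fun ω => ?_
      simp only [queue]
      gcongr
      exact le_max_left _ _
    rw [integral_add (f := fun ω => P.queue T ω n - P.service T ω n)
        ((P.integrable_queue A T n).sub (P.integrable_service A T n))
        (integrable_arrival A net T n),
      integral_sub (P.integrable_queue A T n) (P.integrable_service A T n),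
      integral_arrival] at h
    push_cast
    linarith

theorem sum_lintegral_queue (T : ℕ) (n : Fin N) :
    ∑ τ ∈ Finset.range T, ∫⁻ ω, ENNReal.ofReal (P.queue τ ω n) ∂(pathLaw net A)
      = ENNReal.ofReal (∑ τ ∈ Finset.range T, ∫ ω, P.queue τ ω n ∂(pathLaw net A)) := by
  rw [ENNReal.ofReal_sum_of_nonneg fun τ _ => P.integral_queue_nonneg A τ n]
  refine Finset.sum_congr rfl fun τ _ => ?_
  rw [ofReal_integral_eq_lintegral_ofReal (P.integrable_queue A τ n)
    ((P.ae_queue_bounds A).mono fun _ h => (h τ n).1)]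

variable {P A}

theorem Stable.exists_sum_le (h : P.Stable A) (n : Fin N) : ∃ b : ℝ, ∀ᶠ T : ℕ in atTop,
    ∑ τ ∈ Finset.range T, ∫ ω, P.queue τ ω n ∂(pathLaw net A) ≤ b * T := by
  obtain ⟨b, hb, hb'⟩ := exists_between (h n)
  refine ⟨b.toReal, ?_⟩
  filter_upwards [eventually_lt_of_limsup_lt hb, eventually_ge_atTop 1] with T hT hT1
  rw [sum_lintegral_queue] at hT
  have hT0 : (T : ENNReal) ≠ 0 := by
    simpa using Nat.one_le_iff_ne_zero.1 hT1
  have h1 := (ENNReal.div_le_iff hT0 (ENNReal.natCast_ne_top T)).1 hT.le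
  have h2 := (ENNReal.ofReal_le_iff_le_toReal
    (ENNReal.mul_ne_top hb'.ne (ENNReal.natCast_ne_top T))).1 h1
  simpa using h2

/-- Under a stable policy all mean backlogs are infinitely often below a common bound. -/
theorem Stable.exists_frequently_le (h : P.Stable A) :
    ∃ B : ℝ, ∃ᶠ T in atTop, ∀ n, ∫ ω, P.queue T ω n ∂(pathLaw net A) ≤ B := by
  choose b hb using h.exists_sum_le
  have h0 : ∀ t, 0 ≤ ∑ n, ∫ ω, P.queue t ω n ∂(pathLaw net A) :=
    fun t => Finset.sum_nonneg fun n _ => P.integral_queue_nonneg A t n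
  -- Summing over the nodes before extracting times yields the same infinite set of times for all
  -- nodes.
  have h1 : ∀ᶠ T : ℕ in atTop, ∑ τ ∈ Finset.range T,
      ∑ n, ∫ ω, P.queue τ ω n ∂(pathLaw net A) ≤ (∑ n, b n) * T := by
    filter_upwards [eventually_all.2 hb] with T hT
    rw [Finset.sum_comm, Finset.sum_mul]
    exact Finset.sum_le_sum fun n _ => hT n
  refine ⟨(∑ n, b n) + 1, (frequently_le_of_sum_le h0 h1).mono fun T hT n => ?_⟩
  exact (Finset.single_le_sum (f := fun n => ∫ ω, P.queue T ω n ∂(pathLaw net A))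
    (fun n _ => P.integral_queue_nonneg A T n) (Finset.mem_univ n)).trans hT

theorem stable_of_sum_le {C : ℝ} (n : Fin N) (h : ∀ T : ℕ,
    ∑ τ ∈ Finset.range T, ∫ ω, P.queue τ ω n ∂(pathLaw net A) ≤ C * T) :
    limsup (fun T : ℕ =>
    (∑ τ ∈ Finset.range T, ∫⁻ ω, ENNReal.ofReal (P.queue τ ω n) ∂(pathLaw net A))
      / (T : ENNReal)) atTop < ⊤ := by
  refine lt_of_le_of_lt (limsup_le_of_le (a := ENNReal.ofReal C) (by isBoundedDefault) ?_)
    ENNReal.ofReal_lt_top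
  filter_upwards [eventually_ge_atTop 1] with T hT1
  have hT0 : (T : ENNReal) ≠ 0 := by
    simpa using Nat.one_le_iff_ne_zero.1 hT1
  rw [sum_lintegral_queue, ENNReal.div_le_iff hT0 (ENNReal.natCast_ne_top T)]
  refine (ENNReal.ofReal_le_ofReal (h T)).trans ?_
  rw [ENNReal.ofReal_mul' (Nat.cast_nonneg T), ENNReal.ofReal_natCast]

end Policy

end Policies

end SensorNet

/-! ### Outer bound on the capacity region. -/

namespace SensorNet

section Capacity

variable {N : ℕ} {K : Type} [Fintype K] [MeasurableSpace K] [MeasurableSingletonClass K]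

namespace Policy

variable {net : Network N K} (P : Policy net) (A : Arrival N)

/-- The conditional probability that `n` transmits in slot `t`, given channel state `k`. -/
noncomputable def txProb (t : ℕ) (n : Fin N) (k : K) : ℝ :=
  (pathLaw net A).real {ω | P.tx t ω n = true ∧ (ω t).1 = k} / chanProb net k

theorem measurableSet_tx_chan (t : ℕ) (n : Fin N) (k : K) :
    MeasurableSet {ω : Path N K | P.tx t ω n = true ∧ (ω t).1 = k} :=
  (P.measurable_tx t n (measurableSet_singleton true)).inter
    ((measurable_pi_apply t).fst (measurableSet_singleton k))

/-- At most one node transmits, so the events are disjoint in `n` and lie in the event of channel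
state `k`. For a state of probability 0 the quotient is 0 by convention. -/
theorem isTransmission_txProb (t : ℕ) : IsTransmission (P.txProb A t) := by
  refine ⟨fun n k => div_nonneg measureReal_nonneg (chanProb_nonneg net k), fun k Ac => ?_⟩
  simp only [txProb]
  rw [← Finset.sum_div]
  refine div_le_one_of_le₀ ?_ (chanProb_nonneg net k)
  rw [← measureReal_biUnion_finset
    (fun n _ m _ hnm => Set.disjoint_left.2 fun ω hn hm => hnm (P.tx_unique t ω n m hn.1 hm.1))
    (fun n _ => P.measurableSet_tx_chan t n k), ← pathLaw_chan_real net A t k]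
  refine measureReal_mono fun ω hω => ?_
  simp only [Set.mem_iUnion] at hω
  obtain ⟨n, _, hn⟩ := hω
  exact hn.2

theorem integral_service (t : ℕ) (n : Fin N) :
    ∫ ω, P.service t ω n ∂(pathLaw net A) = offeredRate net (P.txProb A t) n := by
  classical
  have h : ∀ ω, P.service t ω n
      = ∑ k, {ω | P.tx t ω n = true ∧ (ω t).1 = k}.indicator (fun _ => net.rate n k) ω := by
    intro ω
    rw [Finset.sum_eq_single (ω t).1]
    · simp [service, Set.indicator_apply]
    · intro k _ hk
      simp [hk.symm]
    · simp
  simp_rw [h]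
  rw [integral_finsetSum _ fun k _ =>
    (integrable_const _).indicator (P.measurableSet_tx_chan t n k)]
  refine Finset.sum_congr rfl fun k _ => ?_
  rw [integral_indicator_const _ (P.measurableSet_tx_chan t n k), smul_eq_mul]
  congr 1
  -- A null channel state contributes nothing on either side, so the default value of the quotient
  -- is harmless.
  rcases eq_or_ne (chanProb net k) 0 with h0 | h0
  · rw [h0, zero_mul]
    refine le_antisymm ?_ measureReal_nonneg
    rw [← h0, ← pathLaw_chan_real net A t k]
    exact measureReal_mono fun ω hω => hω.2
  · rw [txProb, mul_div_cancel₀ _ h0]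

end Policy

theorem convex_isTransmission : Convex ℝ {tr : Fin N → K → ℝ | IsTransmission tr} := by
  intro x hx y hy a b ha hb hab
  refine ⟨fun n k => ?_, fun k Ac => ?_⟩
  · have h1 := hx.1 n k
    have h2 := hy.1 n k
    simp only [Pi.add_apply, Pi.smul_apply, smul_eq_mul]
    positivity
  · simp only [Pi.add_apply, Pi.smul_apply, smul_eq_mul]
    rw [Finset.sum_add_distrib, ← Finset.mul_sum, ← Finset.mul_sum]
    nlinarith [hx.2 k Ac, hy.2 k Ac]

theorem offeredRate_combination (net : Network N K) (x y : Fin N → K → ℝ) (a b : ℝ) (n : Fin N) :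
    offeredRate net (a • x + b • y) n = a * offeredRate net x n + b * offeredRate net y n := by
  simp only [offeredRate, Pi.add_apply, Pi.smul_apply, smul_eq_mul]
  rw [Finset.mul_sum, Finset.mul_sum, ← Finset.sum_add_distrib]
  exact Finset.sum_congr rfl fun k _ => by ring

/-- The rate vectors dominated by the rates offered by some transmission probabilities. -/
def achievableRates (net : Network N K) : Set (Fin N → ℝ) :=
  {r | ∃ tr, IsTransmission tr ∧ ∀ n, r n ≤ offeredRate net tr n}

theorem convex_achievableRates (net : Network N K) : Convex ℝ (achievableRates net) := by
  rintro x ⟨u, hu, hxu⟩ y ⟨v, hv, hyv⟩ a b ha hb hab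
  refine ⟨a • u + b • v, convex_isTransmission hu hv ha hb hab, fun n => ?_⟩
  rw [offeredRate_combination]
  simp only [Pi.add_apply, Pi.smul_apply, smul_eq_mul]
  exact add_le_add (mul_le_mul_of_nonneg_left (hxu n) ha) (mul_le_mul_of_nonneg_left (hyv n) hb)

/-- In each slot the mean service is offered by the conditional transmission probabilities; the time
average is a convex combination of these. -/
theorem Policy.average_service_mem_achievableRates {net : Network N K} (P : Policy net)
    (A : Arrival N) {T : ℕ} (hT : 1 ≤ T) :
    (fun n => (T : ℝ)⁻¹ * ∑ τ ∈ Finset.range T, ∫ ω, P.service τ ω n ∂(pathLaw net A))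
      ∈ achievableRates net := by
  have hT0 : (T : ℝ) ≠ 0 := by exact_mod_cast Nat.one_le_iff_ne_zero.1 hT
  have h := (convex_achievableRates net).sum_mem (t := Finset.range T)
    (w := fun _ => (T : ℝ)⁻¹)
    (z := fun τ n => ∫ ω, P.service τ ω n ∂(pathLaw net A))
    (fun _ _ => by positivity) (by simp [hT0])
    (fun τ _ => ⟨P.txProb A τ, P.isTransmission_txProb A τ,
      fun n => (P.integral_service A τ n).le⟩)
  convert h using 1
  funext n
  simp [Finset.mul_sum]

theorem Policy.mean_sub_le {net : Network N K} (P : Policy net) (A : Arrival N) {T : ℕ}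
    (hT : 1 ≤ T) {B : ℝ} {n : Fin N} (hB : ∫ ω, P.queue T ω n ∂(pathLaw net A) ≤ B) :
    A.mean n - B / T
      ≤ (T : ℝ)⁻¹ * ∑ τ ∈ Finset.range T, ∫ ω, P.service τ ω n ∂(pathLaw net A) := by
  have hT0 : (0 : ℝ) < T := by exact_mod_cast hT
  have h1 := P.mul_mean_le A T n
  rw [inv_mul_eq_div, le_div_iff₀ hT0, sub_mul, div_mul_cancel₀ _ hT0.ne']
  linarith

/-- At infinitely many times the mean backlog is at most `B`, so average service falls short of the
arrival rate by at most `B / T`, which vanishes. -/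
theorem Policy.Stable.mean_mem_closure {net : Network N K} {P : Policy net} {A : Arrival N}
    (h : P.Stable A) : A.mean ∈ closure (achievableRates net) := by
  obtain ⟨B, hB⟩ := h.exists_frequently_le
  have hlim : Tendsto (fun (T : ℕ) n => A.mean n - B / T) atTop (𝓝 A.mean) := by
    rw [tendsto_pi_nhds]
    intro n
    simpa using (tendsto_const_nhds (x := A.mean n)).sub (tendsto_const_div_atTop_nhds_zero_nat B)
  refine mem_closure_of_frequently_of_tendsto ?_ hlim
  refine (hB.and_eventually (eventually_ge_atTop 1)).mono fun T ⟨hT, hT1⟩ => ?_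
  obtain ⟨tr, htr, hle⟩ := P.average_service_mem_achievableRates A hT1
  refine ⟨tr, htr, fun n => le_trans ?_ (hle n)⟩
  exact P.mean_sub_le A hT1 (hT n)

theorem capacityRegion_subset (net : Network N K) :
    capacityRegion net ⊆ closure (achievableRates net) := by
  refine closure_minimal (convexHull_min ?_ (convex_achievableRates net).closure) isClosed_closure
  rintro r ⟨A, rfl, P, hP⟩
  exact hP.mean_mem_closure

/-- A rate vector strictly inside the capacity region can be offered with some slack. -/
theorem exists_offeredRate_gt {net : Network N K} {lam : Fin N → ℝ} {δ : ℝ} (hδ : 0 < δ)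
    (h : (fun n => lam n + δ) ∈ capacityRegion net) :
    ∃ tr, IsTransmission tr ∧ ∃ γ : ℝ, 0 < γ ∧ ∀ n, lam n + γ ≤ offeredRate net tr n := by
  obtain ⟨g, ⟨tr, htr, hg⟩, hd⟩ :=
    Metric.mem_closure_iff.1 (capacityRegion_subset net h) (δ / 2) (half_pos hδ)
  refine ⟨tr, htr, δ / 2, half_pos hδ, fun n => ?_⟩
  have h1 := (dist_le_pi_dist _ g n).trans hd.le
  rw [Real.dist_eq] at h1
  have := (abs_le.1 h1).2
  linarith [hg n]

end Capacity

end SensorNet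

/-! ### Mode chains and energy of stationary randomized policies. -/

namespace SensorNet

section Chain

variable {N : ℕ} {K : Type} [Fintype K] [MeasurableSpace K] [MeasurableSingletonClass K]

/-- The average energy per slot when node `n` is active with probability `σ n`. -/
noncomputable def energyRate (net : Network N K) (p : Fin N → K → Bool → Bool → ℝ)
    (tr : Fin N → K → ℝ) (σ : Fin N → ℝ) : ℝ :=
  ∑ n, (σ n * net.c n + σ n * offeredRate net tr n * net.α n + (1 - σ n) * net.e0 n
    + σ n * meanSwitch net p n true false * net.e10 n
    + (1 - σ n) * meanSwitch net p n false true * net.e01 n)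

theorem continuous_energyRate (net : Network N K) (p : Fin N → K → Bool → Bool → ℝ)
    (tr : Fin N → K → ℝ) : Continuous (energyRate net p tr) := by
  unfold energyRate
  fun_prop

/-- For fixed `p` and `tr` the energy rate is affine in the activity, so it commutes with time
averages. -/
theorem average_energyRate (net : Network N K) (p : Fin N → K → Bool → Bool → ℝ)
    (tr : Fin N → K → ℝ) (a : ℕ → Fin N → ℝ) {T : ℕ} (hT : 1 ≤ T) :
    (T : ℝ)⁻¹ * ∑ τ ∈ Finset.range T, energyRate net p tr (a τ)
      = energyRate net p tr (fun n => (T : ℝ)⁻¹ * ∑ τ ∈ Finset.range T, a τ n) := by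
  have hT0 : (T : ℝ) ≠ 0 := by exact_mod_cast Nat.one_le_iff_ne_zero.1 hT
  simp only [energyRate]
  rw [Finset.sum_comm, Finset.mul_sum]
  refine Finset.sum_congr rfl fun n _ => ?_
  simp only [sub_mul, one_mul, Finset.sum_add_distrib, Finset.sum_sub_distrib,
    ← Finset.sum_mul, Finset.sum_const, Finset.card_range, nsmul_eq_mul]
  field_simp

namespace RND

variable (θ : RND N K) (net : Network N K) (A : Arrival N)

/-- The indicator that node `n` is active in slot `t`. -/
noncomputable def active (t : ℕ) (ω : Path N K) (n : Fin N) : ℝ :=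
  if θ.mode net.initMode t ω n then 1 else 0

theorem measurable_active (t : ℕ) (n : Fin N) : Measurable fun ω => θ.active net t ω n :=
  Measurable.ite (θ.measurable_mode net.initMode t n (measurableSet_singleton true))
    measurable_const measurable_const

theorem dependsOn_active (t : ℕ) (n : Fin N) :
    DependsOn (fun ω => θ.active net t ω n) (Set.Iio t) := by
  intro ω ω' h
  simp only [active, θ.mode_causal net.initMode t ω ω' fun τ hτ => h τ hτ]

theorem active_nonneg (t : ℕ) (ω : Path N K) (n : Fin N) : 0 ≤ θ.active net t ω n := by
  unfold active; split_ifs <;> norm_num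

theorem active_le_one (t : ℕ) (ω : Path N K) (n : Fin N) : θ.active net t ω n ≤ 1 := by
  unfold active; split_ifs <;> norm_num

theorem active_succ (t : ℕ) (ω : Path N K) (n : Fin N) :
    θ.active net (t + 1) ω n = θ.active net t ω n * θ.wakes n true (ω t)
      + (1 - θ.active net t ω n) * θ.wakes n false (ω t) := by
  cases h : θ.mode net.initMode t ω n <;> simp [active, mode, wakes, h]

theorem service_eq (t : ℕ) (ω : Path N K) (n : Fin N) :
    (θ.policy net).service t ω n = θ.active net t ω n * θ.offered net n (ω t) := by
  classical
  cases h : θ.mode net.initMode t ω n <;>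
    simp [Policy.service, policy, tx, active, offered, h]

/-- Switching indicators become products of a factor fixed before slot `t` and a function of slot
`t`, so that independence gives their expectations. -/
theorem energy_eq (t : ℕ) (ω : Path N K) :
    (θ.policy net).energy t ω = ∑ n, (θ.active net t ω n * net.c n
      + (θ.policy net).service t ω n * net.α n + (1 - θ.active net t ω n) * net.e0 n
      + (θ.active net t ω n - θ.active net t ω n * θ.wakes n true (ω t)) * net.e10 n
      + (θ.wakes n false (ω t) - θ.active net t ω n * θ.wakes n false (ω t)) * net.e01 n) := by
  refine Finset.sum_congr rfl fun n _ => ?_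
  have hs := θ.service_eq net t ω n
  have h1 : θ.active net (t + 1) ω n = if (θ.policy net).mode (t + 1) ω n then 1 else 0 := rfl
  rw [active_succ] at h1
  have h0 : (θ.policy net).mode t ω n = θ.mode net.initMode t ω n := rfl
  rw [h0]
  cases h : θ.mode net.initMode t ω n <;> cases h' : (θ.policy net).mode (t + 1) ω n <;>
    simp only [active, h, h'] at hs h1 <;>
    simp [active, h, Policy.switchEnergy] at hs h1 ⊢ <;> simp [hs, h1]

theorem wakes_bound (n : Fin N) (i : Bool) (s : Slot N K) : ‖θ.wakes n i s‖ ≤ 1 := by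
  unfold wakes; split_ifs <;> simp

theorem integrable_mul_active {Y : Path N K → ℝ} (hY : Integrable Y (pathLaw net A)) (t : ℕ)
    (n : Fin N) : Integrable (fun ω => Y ω * θ.active net t ω n) (pathLaw net A) := by
  refine hY.mul_bdd (c := 1) (θ.measurable_active net t n).aestronglyMeasurable
    (Eventually.of_forall fun ω => ?_)
  rw [Real.norm_of_nonneg (θ.active_nonneg net t ω n)]
  exact θ.active_le_one net t ω n

theorem integrable_mul_wakes {Y : Path N K → ℝ} (hY : Integrable Y (pathLaw net A)) (t : ℕ)
    (n : Fin N) (i : Bool) : Integrable (fun ω => Y ω * θ.wakes n i (ω t)) (pathLaw net A) :=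
  hY.mul_bdd (c := 1) ((θ.measurable_wakes n i).comp (measurable_pi_apply t)).aestronglyMeasurable
    (Eventually.of_forall fun ω => θ.wakes_bound n i (ω t))

theorem integrable_active (t : ℕ) (n : Fin N) :
    Integrable (fun ω => θ.active net t ω n) (pathLaw net A) := by
  simpa using θ.integrable_mul_active net A (integrable_const (1 : ℝ)) t n

theorem integral_mul_wakes {Y : Path N K → ℝ} (hY : Measurable Y) {t : ℕ}
    (hdep : DependsOn Y (Set.Iio t)) (n : Fin N) (i : Bool) :
    ∫ ω, Y ω * θ.wakes n i (ω t) ∂(pathLaw net A)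
      = (∫ ω, Y ω ∂(pathLaw net A)) * meanSwitch net θ.p n i true := by
  rw [integral_mul_eval_of_dependsOn net A hY hdep (θ.measurable_wakes n i), integral_wakes]

theorem integral_mul_service {Y : Path N K → ℝ} (hY : Measurable Y) {t : ℕ}
    (hdep : DependsOn Y (Set.Iio t)) (n : Fin N) :
    ∫ ω, Y ω * (θ.policy net).service t ω n ∂(pathLaw net A)
      = (∫ ω, Y ω * θ.active net t ω n ∂(pathLaw net A)) * offeredRate net θ.tr n := by
  have hYa : Measurable fun ω => Y ω * θ.active net t ω n := hY.mul (θ.measurable_active net t n)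
  have hda : DependsOn (fun ω => Y ω * θ.active net t ω n) (Set.Iio t) := fun ω ω' h => by
    simp only [hdep h, θ.dependsOn_active net t n h]
  rw [← θ.integral_offered net A n,
    ← integral_mul_eval_of_dependsOn net A hYa hda (θ.measurable_offered net n)]
  simp_rw [service_eq, mul_assoc]

/-- The weight `Y` allows two uses: `Y = 1` gives the evolution of the mode probabilities, and `Y` a
backlog gives that of the backlog-mode correlation. -/
theorem integral_mul_active_succ {Y : Path N K → ℝ} (hY : Measurable Y)
    (hint : Integrable Y (pathLaw net A)) {t : ℕ} (hdep : DependsOn Y (Set.Iio t)) (n : Fin N) :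
    ∫ ω, Y ω * θ.active net (t + 1) ω n ∂(pathLaw net A)
      = (∫ ω, Y ω * θ.active net t ω n ∂(pathLaw net A)) * meanSwitch net θ.p n true true
        + (∫ ω, Y ω ∂(pathLaw net A) - ∫ ω, Y ω * θ.active net t ω n ∂(pathLaw net A))
          * meanSwitch net θ.p n false true := by
  have hYa : Measurable fun ω => Y ω * θ.active net t ω n := hY.mul (θ.measurable_active net t n)
  have hia := θ.integrable_mul_active net A hint t n
  have his : Integrable (fun ω => Y ω - Y ω * θ.active net t ω n) (pathLaw net A) := hint.sub hia
  have hda : DependsOn (fun ω => Y ω * θ.active net t ω n) (Set.Iio t) := fun ω ω' h => by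
    simp only [hdep h, θ.dependsOn_active net t n h]
  have hds : DependsOn (fun ω => Y ω - Y ω * θ.active net t ω n) (Set.Iio t) := fun ω ω' h => by
    simp only [hdep h, θ.dependsOn_active net t n h]
  have h : ∀ ω, Y ω * θ.active net (t + 1) ω n
      = Y ω * θ.active net t ω n * θ.wakes n true (ω t)
        + (Y ω - Y ω * θ.active net t ω n) * θ.wakes n false (ω t) := by
    intro ω; rw [active_succ]; ring
  simp_rw [h]
  rw [integral_add (θ.integrable_mul_wakes net A hia t n true)
      (θ.integrable_mul_wakes net A his t n false),
    θ.integral_mul_wakes net A hYa hda,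
    θ.integral_mul_wakes net A (Y := fun ω => Y ω - Y ω * θ.active net t ω n) (hY.sub hYa) hds,
    integral_sub hint hia]

/-- The probability that node `n` is active in slot `t`. -/
noncomputable def activeProb (t : ℕ) (n : Fin N) : ℝ := ∫ ω, θ.active net t ω n ∂(pathLaw net A)

theorem activeProb_nonneg (t : ℕ) (n : Fin N) : 0 ≤ θ.activeProb net A t n :=
  integral_nonneg fun ω => θ.active_nonneg net t ω n

theorem activeProb_le_one (t : ℕ) (n : Fin N) : θ.activeProb net A t n ≤ 1 := by
  have h := integral_mono (θ.integrable_active net A t n) (integrable_const (1 : ℝ))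
    (fun ω => θ.active_le_one net t ω n)
  simpa [activeProb] using h

theorem activeProb_succ (t : ℕ) (n : Fin N) :
    θ.activeProb net A (t + 1) n - θ.activeProb net A t n
      = (1 - θ.activeProb net A t n) * meanSwitch net θ.p n false true
        - θ.activeProb net A t n * meanSwitch net θ.p n true false := by
  have h := θ.integral_mul_active_succ net A (Y := fun _ => 1) measurable_const
    (integrable_const _) (t := t) (fun _ _ _ => rfl) n
  have h2 := meanSwitch_add net θ.isSwitching n true
  simp only [one_mul, integral_const, probReal_univ, smul_eq_mul] at h
  unfold activeProb
  rw [h]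
  linear_combination (∫ ω, θ.active net t ω n ∂(pathLaw net A)) * h2

theorem integral_service (t : ℕ) (n : Fin N) :
    ∫ ω, (θ.policy net).service t ω n ∂(pathLaw net A)
      = θ.activeProb net A t n * offeredRate net θ.tr n := by
  simpa [activeProb] using θ.integral_mul_service net A (Y := fun _ => 1) measurable_const
    (t := t) (fun _ _ _ => rfl) n

theorem integral_energy (t : ℕ) :
    ∫ ω, (θ.policy net).energy t ω ∂(pathLaw net A)
      = energyRate net θ.p θ.tr (θ.activeProb net A t) := by
  have ia := θ.integrable_active net A t
  have iw : ∀ n i, Integrable (fun ω => θ.wakes n i (ω t)) (pathLaw net A) := fun n i => by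
    simpa using θ.integrable_mul_wakes net A (integrable_const (1 : ℝ)) t n i
  have iaw := fun n i => θ.integrable_mul_wakes net A (ia n) t n i
  have is := (θ.policy net).integrable_service A t
  have i1 := fun n => (ia n).mul_const (net.c n)
  have i2 := fun n => (is n).mul_const (net.α n)
  have i3 := fun n => ((integrable_const (1 : ℝ)).sub (ia n)).mul_const (net.e0 n)
  have i4 := fun n => ((ia n).sub (iaw n true)).mul_const (net.e10 n)
  have i5 := fun n => ((iw n false).sub (iaw n false)).mul_const (net.e01 n)
  have hw : ∀ n i, ∫ ω, θ.wakes n i (ω t) ∂(pathLaw net A) = meanSwitch net θ.p n i true :=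
    fun n i => by
      simpa using θ.integral_mul_wakes net A (Y := fun _ => 1) measurable_const
        (t := t) (fun _ _ _ => rfl) n i
  have haw := fun n i => θ.integral_mul_wakes net A (θ.measurable_active net t n)
    (θ.dependsOn_active net t n) n i
  simp_rw [energy_eq]
  rw [integral_finsetSum]
  · refine Finset.sum_congr rfl fun n _ => ?_
    rw [integral_add, integral_add, integral_add, integral_add]
    · simp_rw [integral_mul_const]
      rw [integral_sub (integrable_const _) (ia n), integral_sub (ia n) (iaw n true),
        integral_sub (iw n false) (iaw n false), haw, haw, hw, integral_service]
      have h2 := meanSwitch_add net θ.isSwitching n true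
      simp only [integral_const, probReal_univ, smul_eq_mul, activeProb]
      linear_combination (-(∫ ω, θ.active net t ω n ∂(pathLaw net A)) * net.e10 n) * h2
    · exact i1 n
    · exact i2 n
    · exact (i1 n).add (i2 n)
    · exact i3 n
    · exact ((i1 n).add (i2 n)).add (i3 n)
    · exact i4 n
    · exact (((i1 n).add (i2 n)).add (i3 n)).add (i4 n)
    · exact i5 n
  · exact fun n _ => ((((i1 n).add (i2 n)).add (i3 n)).add (i4 n)).add (i5 n)

/-- The fraction of the first `T` slots in which node `n` is expected to be active. -/
noncomputable def activeAvg (T : ℕ) (n : Fin N) : ℝ :=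
  (T : ℝ)⁻¹ * ∑ τ ∈ Finset.range T, θ.activeProb net A τ n

theorem activeAvg_nonneg (T : ℕ) (n : Fin N) : 0 ≤ θ.activeAvg net A T n :=
  mul_nonneg (by positivity) (Finset.sum_nonneg fun τ _ => θ.activeProb_nonneg net A τ n)

theorem activeAvg_le_one (T : ℕ) (n : Fin N) : θ.activeAvg net A T n ≤ 1 := by
  rw [activeAvg, inv_mul_eq_div]
  refine div_le_one_of_le₀ ?_ (Nat.cast_nonneg T)
  simpa using Finset.sum_le_card_nsmul (Finset.range T) (fun τ => θ.activeProb net A τ n) 1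
    fun τ _ => θ.activeProb_le_one net A τ n

theorem average_service {T : ℕ} (n : Fin N) :
    (T : ℝ)⁻¹ * ∑ τ ∈ Finset.range T, ∫ ω, (θ.policy net).service τ ω n ∂(pathLaw net A)
      = θ.activeAvg net A T n * offeredRate net θ.tr n := by
  simp_rw [integral_service, ← Finset.sum_mul, activeAvg, mul_assoc]

theorem avgEnergy_eq : (θ.policy net).avgEnergy A
    = limsup (fun T => energyRate net θ.p θ.tr (θ.activeAvg net A T)) atTop := by
  refine limsup_congr ?_
  filter_upwards [eventually_ge_atTop 1] with T hT
  simp_rw [integral_energy, one_div]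
  exact average_energyRate net θ.p θ.tr _ hT

/-- The time averages of the activity satisfy the balance equation in the limit. -/
theorem tendsto_activeAvg_balance (n : Fin N) :
    Tendsto (fun T => (1 - θ.activeAvg net A T n) * meanSwitch net θ.p n false true
      - θ.activeAvg net A T n * meanSwitch net θ.p n true false) atTop (𝓝 0) := by
  have h : ∀ T : ℕ, 1 ≤ T → (1 - θ.activeAvg net A T n) * meanSwitch net θ.p n false true
      - θ.activeAvg net A T n * meanSwitch net θ.p n true false
      = (θ.activeProb net A T n - θ.activeProb net A 0 n) / T := by
    intro T hT
    have hT0 : (T : ℝ) ≠ 0 := by exact_mod_cast Nat.one_le_iff_ne_zero.1 hT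
    -- The averaged imbalance telescopes: each term is the one-slot change of the activity
    -- probability, so no ergodicity is needed.
    rw [← Finset.sum_range_sub (fun τ => θ.activeProb net A τ n) T]
    simp only [activeProb_succ, activeAvg, sub_mul, one_mul, Finset.sum_sub_distrib,
      ← Finset.sum_mul, Finset.sum_const, Finset.card_range, nsmul_eq_mul]
    field_simp
  refine squeeze_zero_norm' ?_ (tendsto_const_div_atTop_nhds_zero_nat (1 : ℝ))
  filter_upwards [eventually_ge_atTop 1] with T hT
  rw [h T hT, Real.norm_eq_abs, abs_div, Nat.abs_cast]
  gcongr
  rw [abs_le]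
  have h1 := θ.activeProb_nonneg net A T n
  have h2 := θ.activeProb_nonneg net A 0 n
  have h3 := θ.activeProb_le_one net A T n
  have h4 := θ.activeProb_le_one net A 0 n
  constructor <;> linarith

variable {θ net A}

/-- A stabilizing stationary policy spends at least the energy of some stationary mode
probabilities for which the offered rates cover the arrival rates. -/
theorem exists_stationary_of_stable (h : (θ.policy net).Stable A) :
    ∃ σ : Fin N → ℝ, (∀ n, 0 ≤ σ n) ∧ (∀ n, σ n ≤ 1) ∧
      (∀ n, (1 - σ n) * meanSwitch net θ.p n false true
        = σ n * meanSwitch net θ.p n true false) ∧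
      (∀ n, A.mean n ≤ σ n * offeredRate net θ.tr n) ∧
      energyRate net θ.p θ.tr σ ≤ (θ.policy net).avgEnergy A := by
  obtain ⟨B, hB⟩ := h.exists_frequently_le
  obtain ⟨φ, hφ, hφB⟩ := extraction_of_frequently_atTop hB
  have hmem : ∀ T, θ.activeAvg net A T ∈ Set.Icc (0 : Fin N → ℝ) 1 := fun T =>
    ⟨fun n => θ.activeAvg_nonneg net A T n, fun n => θ.activeAvg_le_one net A T n⟩
  -- The averages of the activity need not be shown to converge; a limit point along times of
  -- bounded mean backlog suffices.
  obtain ⟨σ, hσ, ψ, hψ, hlim⟩ := isCompact_Icc.tendsto_subseq fun j => hmem (φ j)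
  have hsub : Tendsto (φ ∘ ψ) atTop atTop := hφ.tendsto_atTop.comp hψ.tendsto_atTop
  have hlim_n := tendsto_pi_nhds.1 hlim
  refine ⟨σ, hσ.1, hσ.2, fun n => ?_, fun n => ?_, ?_⟩
  · have h1 := (θ.tendsto_activeAvg_balance net A n).comp hsub
    have h2 := (((tendsto_const_nhds (x := (1 : ℝ))).sub (hlim_n n)).mul_const
      (meanSwitch net θ.p n false true)).sub
      ((hlim_n n).mul_const (meanSwitch net θ.p n true false))
    exact sub_eq_zero.1 (tendsto_nhds_unique h2 h1)
  · have h1 : Tendsto (fun j => A.mean n - B / ((φ ∘ ψ) j : ℕ)) atTop (𝓝 (A.mean n - 0)) :=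
      ((tendsto_const_nhds (x := A.mean n)).sub
        (tendsto_const_div_atTop_nhds_zero_nat B)).comp hsub
    rw [sub_zero] at h1
    refine le_of_tendsto_of_tendsto h1 ((hlim_n n).mul_const _) ?_
    filter_upwards [hsub.eventually_ge_atTop 1] with j hj
    have h2 := (θ.policy net).mean_sub_le A hj (hφB (ψ j) n)
    rwa [average_service] at h2
  · rw [avgEnergy_eq]
    have hc := (continuous_energyRate net θ.p θ.tr).continuousOn (s := Set.Icc 0 1)
    obtain ⟨C, hC⟩ := isCompact_Icc.bddAbove_image hc
    -- The limsup dominates any subsequential limit; compactness of the cube supplies the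
    -- boundedness that a real limsup requires.
    refine le_of_forall_lt_imp_le_of_dense fun c hcl => le_limsup_of_frequently_le ?_ ?_
    · have h1 := ((continuous_energyRate net θ.p θ.tr).tendsto σ).comp hlim
      have h2 := (h1.eventually (eventually_gt_nhds hcl)).frequently
      exact hsub.frequently (h2.mono fun j hj => hj.le)
    · exact isBoundedUnder_of ⟨C, fun T => hC ⟨_, hmem T, rfl⟩⟩

/-- The energy of a policy whose mode chains are ergodic with stationary probabilities `σ`. -/
theorem avgEnergy_eq_of_balance {σ : Fin N → ℝ} {κ : ℝ} (hκ : 0 < κ)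
    (h01 : ∀ n, meanSwitch net θ.p n false true = κ * σ n)
    (h10 : ∀ n, meanSwitch net θ.p n true false = κ * (1 - σ n)) :
    (θ.policy net).avgEnergy A = energyRate net θ.p θ.tr σ := by
  rw [avgEnergy_eq]
  refine (((continuous_energyRate net θ.p θ.tr).tendsto σ).comp
    (tendsto_pi_nhds.2 fun n => ?_)).limsup_eq
  -- Under these switching rates the imbalance is exactly `κ * (σ n - activeAvg)`, so its vanishing
  -- means convergence of the averages to `σ n`.
  have h1 := ((tendsto_const_nhds (x := σ n)).sub
    ((θ.tendsto_activeAvg_balance net A n).const_mul κ⁻¹))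
  rw [mul_zero, sub_zero] at h1
  refine h1.congr fun T => ?_
  rw [h01, h10]
  field_simp
  ring

end RND

end Chain

end SensorNet

/-! ### Stability by Lyapunov drift. -/

namespace SensorNet

/-- A Lyapunov drift bound: `X`, `Z` are the second and first moments of a backlog, and `Y` its
correlation with a mode process that relaxes to its stationary value `σ` at rate `κ`. -/
theorem exists_sum_le_of_drift {X Y Z : ℕ → ℝ} {C C' lam S σ κ : ℝ} (hκ : 0 < κ) (hS : 0 ≤ S)
    (hlt : lam < σ * S)
    (hX : ∀ t, X (t + 1) ≤ X t + C + 2 * lam * Z t - 2 * S * Y t)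
    (hY : ∀ t, κ * σ * Z t - C' - (Y (t + 1) - Y t) ≤ κ * Y t)
    (hXZ : ∀ t, Z t ^ 2 ≤ X t) (hY0 : ∀ t, 0 ≤ Y t) (hYZ : ∀ t, Y t ≤ Z t) :
    ∃ D, ∀ T : ℕ, ∑ τ ∈ Finset.range T, Z τ ≤ D * T := by
  set γ := 2 * (σ * S - lam) with hγ
  have hγ0 : 0 < γ := by linarith
  -- The Lyapunov function is `X - 2 * r * Y`. This `r` makes the correction cancel `2 * S * Y t`
  -- and replace it by `2 * S * σ * Z t`, leaving drift at most `E - γ * Z t`.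
  set r := S / κ with hr
  have hr0 : 0 ≤ r := div_nonneg hS hκ.le
  have hS' : S = r * κ := (div_mul_cancel₀ S hκ.ne').symm
  set E := C + 2 * r * C' with hE
  have key : ∀ T : ℕ, γ * ∑ τ ∈ Finset.range T, Z τ + X T - 2 * r * Y T
      ≤ E * T + X 0 - 2 * r * Y 0 := by
    intro T
    induction T with
    | zero => simp
    | succ T ih =>
      rw [Finset.sum_range_succ]
      push_cast
      have h1 := mul_le_mul_of_nonneg_left (hY T) hr0
      have h2 := hX T
      have h3 : 2 * S * Y T = 2 * (r * (κ * Y T)) := by rw [hS']; ring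
      have h4 : γ * Z T = 2 * (r * (κ * σ * Z T)) - 2 * lam * Z T := by rw [hγ, hS']; ring
      rw [hE] at ih ⊢
      nlinarith
  refine ⟨(E + X 0 + r ^ 2) / γ, fun T => ?_⟩
  rcases Nat.eq_zero_or_pos T with rfl | hT
  · simp
  have hT1 : (1 : ℝ) ≤ T := by exact_mod_cast hT
  rw [div_mul_eq_mul_div, le_div_iff₀ hγ0]
  have h1 := key T
  have h2 : X 0 + r ^ 2 ≤ (X 0 + r ^ 2) * T :=
    le_mul_of_one_le_right (add_nonneg ((sq_nonneg _).trans (hXZ 0)) (sq_nonneg _)) hT1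
  have h3 := mul_le_mul_of_nonneg_left (hYZ T) hr0
  have h4 := mul_nonneg hr0 (hY0 0)
  -- The corrected function is bounded below: `X - 2 * r * Y ≥ Z ^ 2 - 2 * r * Z ≥ -r ^ 2`.
  nlinarith [hXZ T, sq_nonneg (Z T - r)]

section Stability

variable {N : ℕ} {K : Type} [Fintype K] [MeasurableSpace K] [MeasurableSingletonClass K]

namespace Policy

variable {net : Network N K} (P : Policy net) (A : Arrival N)

theorem integrable_queue_mul {Y : Path N K → ℝ} (hY : Integrable Y (pathLaw net A)) (t : ℕ)
    (n : Fin N) : Integrable (fun ω => P.queue t ω n * Y ω) (pathLaw net A) := by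
  refine hY.bdd_mul (c := net.initQueue n + t * A.Rmax)
    (P.measurable_queue t n).aestronglyMeasurable ?_
  filter_upwards [P.ae_queue_bounds A] with ω hω
  rw [Real.norm_of_nonneg (hω t n).1]
  exact (hω t n).2

theorem sq_integral_queue_le (t : ℕ) (n : Fin N) :
    (∫ ω, P.queue t ω n ∂(pathLaw net A)) ^ 2
      ≤ ∫ ω, P.queue t ω n * P.queue t ω n ∂(pathLaw net A) := by
  set z := ∫ ω, P.queue t ω n ∂(pathLaw net A) with hz
  have hi := P.integrable_queue A t n
  have hii := P.integrable_queue_mul A hi t n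
  have h : ∫ ω, (2 * z * P.queue t ω n - z ^ 2) ∂(pathLaw net A)
      ≤ ∫ ω, P.queue t ω n * P.queue t ω n ∂(pathLaw net A) :=
    integral_mono ((hi.const_mul _).sub (integrable_const _)) hii fun ω => by
      dsimp only
      nlinarith [sq_nonneg (P.queue t ω n - z)]
  rw [integral_sub (hi.const_mul _) (integrable_const _), integral_const_mul, ← hz] at h
  simp only [integral_const, probReal_univ, smul_eq_mul] at h
  linarith

theorem integral_queue_sq_succ_le (t : ℕ) (n : Fin N) :
    ∫ ω, P.queue (t + 1) ω n * P.queue (t + 1) ω n ∂(pathLaw net A)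
      ≤ ∫ ω, P.queue t ω n * P.queue t ω n ∂(pathLaw net A)
        + (rateBound net ^ 2 + A.Rmax ^ 2)
        + 2 * A.mean n * ∫ ω, P.queue t ω n ∂(pathLaw net A)
        - 2 * ∫ ω, P.queue t ω n * P.service t ω n ∂(pathLaw net A) := by
  have hi := P.integrable_queue A t n
  have hii := P.integrable_queue_mul A hi t n
  have hR := P.integrable_queue_mul A (integrable_arrival A net t n) t n
  have hs := P.integrable_queue_mul A (P.integrable_service A t n) t n
  have h : ∫ ω, P.queue (t + 1) ω n * P.queue (t + 1) ω n ∂(pathLaw net A)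
      ≤ ∫ ω, (P.queue t ω n * P.queue t ω n + (rateBound net ^ 2 + A.Rmax ^ 2)
        + 2 * (P.queue t ω n * (ω t).2.1 n) - 2 * (P.queue t ω n * P.service t ω n))
          ∂(pathLaw net A) := by
    refine integral_mono_ae (P.integrable_queue_mul A (P.integrable_queue A (t + 1) n) (t + 1) n)
      (((hii.add (integrable_const _)).add (hR.const_mul 2)).sub (hs.const_mul 2)) ?_
    filter_upwards [P.ae_queue_bounds A, ae_arrival_bounds net A] with ω hq hr
    have hq0 := (hq t n).1
    obtain ⟨hr0, hr1⟩ := hr t n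
    have hs0 := P.service_nonneg t ω n
    have hs1 := P.service_le t ω n
    simp only [queue]
    set q := P.queue t ω n
    set s := P.service t ω n
    set x := (ω t).2.1 n
    have hx2 : x ^ 2 ≤ A.Rmax ^ 2 := pow_le_pow_left₀ hr0 hr1 2
    have hs2 : s ^ 2 ≤ rateBound net ^ 2 := pow_le_pow_left₀ hs0 hs1 2
    -- If the queue empties, `(q - s) ^ 2 ≥ 0` pays for the lost term; otherwise expand the square
    -- and drop `-2 * s * x`.
    rcases max_cases (q - s) 0 with ⟨hm, _⟩ | ⟨hm, _⟩ <;> rw [hm]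
    · nlinarith [mul_nonneg hr0 hs0]
    · nlinarith [mul_nonneg hr0 hq0, sq_nonneg (q - s)]
  rw [integral_sub (f := fun ω => P.queue t ω n * P.queue t ω n
        + (rateBound net ^ 2 + A.Rmax ^ 2) + 2 * (P.queue t ω n * (ω t).2.1 n))
      ((hii.add (integrable_const _)).add (hR.const_mul 2)) (hs.const_mul 2),
    integral_add (f := fun ω => P.queue t ω n * P.queue t ω n
        + (rateBound net ^ 2 + A.Rmax ^ 2)) (hii.add (integrable_const _)) (hR.const_mul 2),
    integral_add hii (integrable_const _), integral_const_mul, integral_const_mul,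
    integral_mul_eval_of_dependsOn net A (P.measurable_queue t n) (P.dependsOn_queue t n)
      (g := fun s => s.2.1 n) ((measurable_pi_apply n).comp measurable_snd.fst),
    integral_slotLaw_arrival] at h
  simp only [integral_const, probReal_univ, smul_eq_mul] at h
  linarith

end Policy

namespace RND

variable {θ : RND N K} {net : Network N K} {A : Arrival N}

/-- A backlog drops by at most `rateBound net` per slot, so in the correlation with the next mode it
may be replaced by its earlier value, to which the mode recursion applies. -/
theorem integral_queue_mul_active_succ_ge (t : ℕ) (n : Fin N) :
    ∫ ω, (θ.policy net).queue t ω n * θ.active net (t + 1) ω n ∂(pathLaw net A) - rateBound net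
      ≤ ∫ ω, (θ.policy net).queue (t + 1) ω n * θ.active net (t + 1) ω n ∂(pathLaw net A) := by
  have hi := θ.integrable_mul_active net A ((θ.policy net).integrable_queue A t n) (t + 1) n
  have h : ∫ ω, ((θ.policy net).queue t ω n * θ.active net (t + 1) ω n - rateBound net)
      ∂(pathLaw net A)
      ≤ ∫ ω, (θ.policy net).queue (t + 1) ω n * θ.active net (t + 1) ω n ∂(pathLaw net A) := by
    refine integral_mono_ae (hi.sub (integrable_const _))
      (θ.integrable_mul_active net A ((θ.policy net).integrable_queue A (t + 1) n) (t + 1) n) ?_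
    filter_upwards [ae_arrival_bounds net A] with ω hr
    have h0 := θ.active_nonneg net (t + 1) ω n
    have h1 := θ.active_le_one net (t + 1) ω n
    have hs := (θ.policy net).service_le t ω n
    have hb := rateBound_nonneg net
    have hq : (θ.policy net).queue t ω n - rateBound net
        ≤ (θ.policy net).queue (t + 1) ω n := by
      have := le_max_left ((θ.policy net).queue t ω n - (θ.policy net).service t ω n) 0
      simp only [Policy.queue]
      linarith [(hr t n).1]
    nlinarith [mul_le_mul_of_nonneg_right hq h0]
  rw [integral_sub hi (integrable_const _)] at h
  simpa using h

/-- A stationary policy with ergodic mode chains is stable if it offers more than it must. -/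
theorem stable_of_balance {σ : Fin N → ℝ} {κ : ℝ} (hκ : 0 < κ)
    (h01 : ∀ n, meanSwitch net θ.p n false true = κ * σ n)
    (h10 : ∀ n, meanSwitch net θ.p n true false = κ * (1 - σ n))
    (hlt : ∀ n, A.mean n < σ n * offeredRate net θ.tr n) : (θ.policy net).Stable A := by
  intro n
  set P := θ.policy net
  have hq := P.integrable_queue A
  obtain ⟨D, hD⟩ := exists_sum_le_of_drift
    (X := fun t => ∫ ω, P.queue t ω n * P.queue t ω n ∂(pathLaw net A))
    (Y := fun t => ∫ ω, P.queue t ω n * θ.active net t ω n ∂(pathLaw net A))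
    (Z := fun t => ∫ ω, P.queue t ω n ∂(pathLaw net A))
    (C := rateBound net ^ 2 + A.Rmax ^ 2) (C' := rateBound net) hκ
    (offeredRate_nonneg net θ.isTransmission.1 n) (hlt n)
    (fun t => by
      have h := P.integral_queue_sq_succ_le A t n
      rw [θ.integral_mul_service net A (P.measurable_queue t n) (P.dependsOn_queue t n)] at h
      linarith)
    -- With total switching rate `κ`, the mode recursion weighted by the backlog reads `Y + κ * (σ *
    -- Z - Y)`; the change of backlog costs `rateBound net`.
    (fun t => by
      have h := integral_queue_mul_active_succ_ge (θ := θ) (net := net) (A := A) t n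
      rw [θ.integral_mul_active_succ net A (P.measurable_queue t n) (hq t n)
        (P.dependsOn_queue t n), h01] at h
      have h2 := meanSwitch_add net θ.isSwitching n true
      rw [h10] at h2
      have h3 : meanSwitch net θ.p n true true = 1 - κ * (1 - σ n) := by linarith
      rw [h3] at h
      linarith)
    (fun t => P.sq_integral_queue_le A t n)
    (fun t => integral_nonneg_of_ae ((P.ae_queue_bounds A).mono fun ω h =>
      mul_nonneg (h t n).1 (θ.active_nonneg net t ω n)))
    (fun t => integral_mono_ae (θ.integrable_mul_active net A (hq t n) t n) (hq t n)
      ((P.ae_queue_bounds A).mono fun ω h =>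
        mul_le_of_le_one_right (h t n).1 (θ.active_le_one net t ω n)))
  exact Policy.stable_of_sum_le n hD

end RND

end Stability

end SensorNet

/-! ### The static problem and its equivalence with policies and with the optimization problem. -/

namespace SensorNet

section StaticProblem

variable {N : ℕ} {K : Type} [Fintype K] [MeasurableSpace K] [MeasurableSingletonClass K]

/-- Activity and transmission probabilities whose service rates cover the arrival rates `lam`. -/
def IsStatic (net : Network N K) (lam : Fin N → ℝ) (x : (Fin N → ℝ) × (Fin N → K → ℝ)) : Prop :=
  (∀ n, 0 ≤ x.1 n ∧ x.1 n ≤ 1) ∧ IsTransmission x.2 ∧ ∀ n, lam n ≤ x.1 n * offeredRate net x.2 n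

/-- The average energy per slot when no energy is spent on switching. -/
noncomputable def baseEnergy (net : Network N K) (x : (Fin N → ℝ) × (Fin N → K → ℝ)) : ℝ :=
  ∑ n, (x.1 n * net.c n + x.1 n * offeredRate net x.2 n * net.α n + (1 - x.1 n) * net.e0 n)

theorem continuous_baseEnergy (net : Network N K) : Continuous (baseEnergy net) := by
  unfold baseEnergy offeredRate
  fun_prop

theorem energyRate_eq_baseEnergy_add (net : Network N K) (p : Fin N → K → Bool → Bool → ℝ)
    (tr : Fin N → K → ℝ) (σ : Fin N → ℝ) :
    energyRate net p tr σ = baseEnergy net (σ, tr)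
      + ∑ n, (σ n * meanSwitch net p n true false * net.e10 n
        + (1 - σ n) * meanSwitch net p n false true * net.e01 n) := by
  rw [energyRate, baseEnergy, ← Finset.sum_add_distrib]
  exact Finset.sum_congr rfl fun n _ => by ring

theorem baseEnergy_le_energyRate (net : Network N K) {p : Fin N → K → Bool → Bool → ℝ}
    (hp : IsSwitching p) (tr : Fin N → K → ℝ) {σ : Fin N → ℝ} (h : ∀ n, 0 ≤ σ n ∧ σ n ≤ 1) :
    baseEnergy net (σ, tr) ≤ energyRate net p tr σ := by
  rw [energyRate_eq_baseEnergy_add]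
  have hm : ∀ n i j, 0 ≤ meanSwitch net p n i j := fun n i j =>
    Finset.sum_nonneg fun k _ => mul_nonneg (chanProb_nonneg net k) (hp.1 n k i j)
  refine le_add_of_nonneg_right (Finset.sum_nonneg fun n _ => add_nonneg ?_ ?_)
  · exact mul_nonneg (mul_nonneg (h n).1 (hm n _ _)) (net.e10_nonneg n)
  · exact mul_nonneg (mul_nonneg (sub_nonneg.2 (h n).2) (hm n _ _)) (net.e01_nonneg n)

theorem IsStatic.anti {net : Network N K} {lam lam' : Fin N → ℝ} (hle : ∀ n, lam n ≤ lam' n)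
    {x : (Fin N → ℝ) × (Fin N → K → ℝ)} (h : IsStatic net lam' x) : IsStatic net lam x :=
  ⟨h.1, h.2.1, fun n => (hle n).trans (h.2.2 n)⟩

theorem isCompact_isStatic (net : Network N K) (lam : Fin N → ℝ) :
    IsCompact {x | IsStatic net lam x} := by
  refine (isCompact_Icc (a := (0 : (Fin N → ℝ) × (Fin N → K → ℝ))) (b := 1)).of_isClosed_subset
    ?_ fun x hx => ⟨⟨fun n => (hx.1 n).1, fun n k => hx.2.1.1 n k⟩,
      ⟨fun n => (hx.1 n).2, fun n k => hx.2.1.le_one n k⟩⟩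
  simp only [IsStatic, IsTransmission, offeredRate, Set.ofPred_and, Set.ofPred_forall]
  refine (isClosed_iInter fun n => ?_).inter
    (((isClosed_iInter fun n => isClosed_iInter fun k => ?_).inter
    (isClosed_iInter fun k => isClosed_iInter fun Ac => ?_)).inter (isClosed_iInter fun n => ?_))
  · exact (isClosed_le (by fun_prop) (by fun_prop)).inter (isClosed_le (by fun_prop) (by fun_prop))
  all_goals exact isClosed_le (by fun_prop) (by fun_prop)

theorem exists_baseEnergy_minimizer (net : Network N K) {lam : Fin N → ℝ}
    {x₀ : (Fin N → ℝ) × (Fin N → K → ℝ)} (h₀ : IsStatic net lam x₀) :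
    ∃ x, IsStatic net lam x ∧ ∀ y, IsStatic net lam y → baseEnergy net x ≤ baseEnergy net y :=
  (isCompact_isStatic net lam).exists_isMinOn ⟨x₀, h₀⟩ (continuous_baseEnergy net).continuousOn

/-- Static points can be perturbed to points with slack, at little extra energy. -/
theorem IsStatic.exists_slack {net : Network N K} {lam : Fin N → ℝ} (hlam : ∀ n, 0 ≤ lam n)
    {x : (Fin N → ℝ) × (Fin N → K → ℝ)} (hx : IsStatic net lam x) {tr : Fin N → K → ℝ}
    (htr : IsTransmission tr) {γ : ℝ} (hγ : 0 < γ) (hs : ∀ n, lam n + γ ≤ offeredRate net tr n)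
    {η : ℝ} (hη : 0 < η) :
    ∃ γ' : ℝ, 0 < γ' ∧ ∃ y, IsStatic net (fun n => lam n + γ') y ∧
      baseEnergy net y < baseEnergy net x + η := by
  -- Mixing in `tr` scales the old rates by `1 - ε`; dividing the activity by `1 - ε` compensates.
  -- The added `ε` wakes nodes with zero activity, and `min 1` keeps a probability.
  let y : ℝ → (Fin N → ℝ) × (Fin N → K → ℝ) := fun ε =>
    (fun n => min 1 ((x.1 n + ε) / (1 - ε)), (1 - ε) • x.2 + ε • tr)
  have hy0 : y 0 = x := by
    ext n
    · simpa [y] using (hx.1 n).2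
    · simp [y]
  have hyc : ContinuousAt y 0 := by
    refine ContinuousAt.prodMk (continuousAt_pi.2 fun n => ?_) (by fun_prop)
    refine continuousAt_const.min (ContinuousAt.div (by fun_prop) (by fun_prop) (by norm_num))
  have hbc := (continuous_baseEnergy net).continuousAt.comp hyc
  have hev : ∀ᶠ ε in 𝓝 (0 : ℝ), baseEnergy net (y ε) < baseEnergy net x + η := by
    refine hbc.eventually_lt continuousAt_const ?_
    simp only [Function.comp_apply, hy0]
    linarith
  have hev' := (hev.and (eventually_lt_nhds one_pos)).filter_mono
    (nhdsWithin_le_nhds (s := Set.Ioi 0))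
  obtain ⟨ε, ⟨hε, hε1⟩, hε0⟩ := (hev'.and self_mem_nhdsWithin).exists
  have hε0 : 0 < ε := hε0
  have hε1' : 0 < 1 - ε := by linarith
  -- The slack is activity at least `ε` times the extra offered rate, at least `ε * γ`.
  refine ⟨ε * ε * γ, by positivity, y ε, ⟨fun n => ⟨?_, min_le_left _ _⟩, ?_, fun n => ?_⟩, hε⟩
  · exact le_min zero_le_one (div_nonneg (by linarith [(hx.1 n).1]) hε1'.le)
  · exact convex_isTransmission hx.2.1 htr hε1'.le hε0.le (by ring)
  · simp only [y]
    rw [offeredRate_combination]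
    have h1 := hx.2.2 n
    have hS := offeredRate_nonneg net hx.2.1.1 n
    have h2 := hs n
    obtain ⟨h3, h4⟩ := hx.1 n
    have h5 := hlam n
    set S := offeredRate net x.2 n
    set S' := offeredRate net tr n
    rcases min_cases 1 ((x.1 n + ε) / (1 - ε)) with ⟨hm, _⟩ | ⟨hm, _⟩ <;> rw [hm]
    · have h6 : lam n ≤ S := h1.trans (mul_le_of_le_one_left hS h4)
      have h7 : ε * (ε * γ) ≤ ε * γ :=
        mul_le_mul_of_nonneg_left (mul_le_of_le_one_left hγ.le hε1.le) hε0.le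
      have h8 := mul_le_mul_of_nonneg_left h6 hε1'.le
      have h9 := mul_le_mul_of_nonneg_left h2 hε0.le
      linarith
    · have h6 : (x.1 n + ε) / (1 - ε) * ((1 - ε) * S + ε * S')
          = (x.1 n + ε) * S + (x.1 n + ε) * (ε * S') / (1 - ε) := by
        field_simp
      have h7 : ε * (ε * γ) ≤ (x.1 n + ε) * (ε * S') := by
        gcongr <;> linarith
      have h8 : (x.1 n + ε) * (ε * S') ≤ (x.1 n + ε) * (ε * S') / (1 - ε) :=
        le_div_self (le_trans (by positivity) h7) hε1' (by linarith)
      rw [h6]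
      nlinarith [mul_nonneg hε0.le hS]

/-- Switching that moves the mode of node `n` towards the activity probability `σ n` at rate
`κ`. -/
def lazySwitch (K : Type) (κ : ℝ) (σ : Fin N → ℝ) (n : Fin N) (_ : K) : Bool → Bool → ℝ
  | false, true => κ * σ n
  | false, false => 1 - κ * σ n
  | true, false => κ * (1 - σ n)
  | true, true => 1 - κ * (1 - σ n)

theorem isSwitching_lazySwitch {κ : ℝ} (h0 : 0 ≤ κ) (h1 : κ ≤ 1) {σ : Fin N → ℝ}
    (hσ : ∀ n, 0 ≤ σ n ∧ σ n ≤ 1) : IsSwitching (lazySwitch K κ σ) := by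
  refine ⟨fun n k i j => ?_, fun n k i => ?_⟩
  · obtain ⟨h2, h3⟩ := hσ n
    cases i <;> cases j <;> simp only [lazySwitch] <;> nlinarith
  · cases i <;> simp [lazySwitch]

theorem meanSwitch_lazySwitch (net : Network N K) (κ : ℝ) (σ : Fin N → ℝ) (n : Fin N)
    (i j : Bool) (k : K) : meanSwitch net (lazySwitch K κ σ) n i j = lazySwitch K κ σ n k i j := by
  unfold meanSwitch
  have h : ∀ k', lazySwitch K κ σ n k' i j = lazySwitch K κ σ n k i j := fun _ => by
    cases i <;> cases j <;> rfl
  simp_rw [h]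
  rw [← Finset.sum_mul, sum_chanProb, one_mul]

/-- Slow switching keeps the activity `σ` and hence stability by slack, while the switching energy
is only `κ * c`. -/
theorem IsStatic.exists_stabilizing {net : Network N K} {A : Arrival N}
    {x : (Fin N → ℝ) × (Fin N → K → ℝ)} {γ : ℝ} (hγ : 0 < γ)
    (hx : IsStatic net (fun n => A.mean n + γ) x) {η : ℝ} (hη : 0 < η) :
    ∃ h ∈ stabilizingEnergies net A, h < baseEnergy net x + η := by
  obtain ⟨k⟩ : Nonempty K := net.chan.support_nonempty.to_type
  obtain ⟨σ, tr⟩ := x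
  obtain ⟨hσ, htr, hs⟩ := hx
  set c := ∑ n, σ n * (1 - σ n) * (net.e10 n + net.e01 n) with hc
  have hc0 : 0 ≤ c := Finset.sum_nonneg fun n _ =>
    mul_nonneg (mul_nonneg (hσ n).1 (sub_nonneg.2 (hσ n).2))
      (add_nonneg (net.e10_nonneg n) (net.e01_nonneg n))
  have hd : 0 < c + 1 + η := by linarith
  -- Positive, at most 1 so that the switching probabilities are valid, and with `κ * c < η`.
  set κ := η / (c + 1 + η)
  have hκ0 : 0 < κ := div_pos hη hd
  have hκ1 : κ ≤ 1 := (div_le_one hd).2 (by linarith)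
  have hκc : κ * c < η := by
    rw [div_mul_eq_mul_div, div_lt_iff₀ hd]
    nlinarith
  let θ : RND N K := ⟨lazySwitch K κ σ, tr, isSwitching_lazySwitch hκ0.le hκ1 hσ, htr⟩
  have h01 : ∀ n, meanSwitch net θ.p n false true = κ * σ n := fun n =>
    meanSwitch_lazySwitch net κ σ n false true k
  have h10 : ∀ n, meanSwitch net θ.p n true false = κ * (1 - σ n) := fun n =>
    meanSwitch_lazySwitch net κ σ n true false k
  refine ⟨_, ⟨θ, RND.stable_of_balance hκ0 h01 h10 fun n => ?_, rfl⟩, ?_⟩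
  · have := hs n
    change A.mean n < σ n * offeredRate net tr n
    dsimp only at this
    linarith
  · rw [RND.avgEnergy_eq_of_balance hκ0 h01 h10, energyRate_eq_baseEnergy_add]
    refine add_lt_add_right (lt_of_eq_of_lt ?_ hκc) _
    rw [hc, Finset.mul_sum]
    refine Finset.sum_congr rfl fun n _ => ?_
    rw [h01, h10]
    ring

theorem exists_isStatic_of_mem_stabilizingEnergies {net : Network N K} {A : Arrival N} {h : ℝ}
    (hh : h ∈ stabilizingEnergies net A) : ∃ x, IsStatic net A.mean x ∧ baseEnergy net x ≤ h := by
  obtain ⟨θ, hst, rfl⟩ := hh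
  obtain ⟨σ, h0, h1, -, hs, he⟩ := RND.exists_stationary_of_stable hst
  exact ⟨(σ, θ.tr), ⟨fun n => ⟨h0 n, h1 n⟩, θ.isTransmission, hs⟩,
    (baseEnergy_le_energyRate net θ.isSwitching θ.tr fun n => ⟨h0 n, h1 n⟩).trans he⟩

/-- The next channel state is drawn independently of the next mode, so under a stationary law mode
and channel are independent; one activity `σ n` then serves all states of positive probability. -/
theorem exists_isStatic_of_mem_feasibleValues {net : Network N K} {lam : Fin N → ℝ} {v : ℝ}
    (hv : v ∈ feasibleValues net lam) : ∃ x, IsStatic net lam x ∧ baseEnergy net x ≤ v := by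
  obtain ⟨p, st, tr, ⟨hp, ⟨hst0, hst1, hbal⟩, htr, hs⟩, rfl⟩ := hv
  let σ : Fin N → ℝ := fun n => ∑ k, chanProb net k * st n k true
  have ha : ∀ n k, chanProb net k * st n k true = chanProb net k * σ n := by
    intro n
    obtain ⟨r, hr⟩ : ∃ r, ∀ k, chanProb net k * st n k true = chanProb net k * r :=
      ⟨∑ j, ∑ i, chanProb net j * st n j i * p n j i true, fun k => by
        rw [hbal, Finset.mul_sum]
        refine Finset.sum_congr rfl fun j _ => ?_
        rw [Finset.mul_sum]
        exact Finset.sum_congr rfl fun i _ => by ring⟩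
    have hσ : σ n = r := by
      simp only [σ, hr]
      rw [← Finset.sum_mul, sum_chanProb, one_mul]
    intro k
    rw [hr, hσ]
  have hb : ∀ n k, chanProb net k * st n k false = chanProb net k * (1 - σ n) := fun n k => by
    have := hst1 n k
    rw [mul_sub, ← ha, ← mul_sub, ← this]
    ring
  have hσ01 : ∀ n, 0 ≤ σ n ∧ σ n ≤ 1 := fun n => by
    refine ⟨Finset.sum_nonneg fun k _ => mul_nonneg (chanProb_nonneg net k) (hst0 n k true), ?_⟩
    rw [← sum_chanProb net]
    refine Finset.sum_le_sum fun k _ => mul_le_of_le_one_right (chanProb_nonneg net k) ?_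
    linarith [hst0 n k false, hst1 n k]
  refine ⟨(σ, tr), ⟨hσ01, htr, fun n => (hs n).trans_eq ?_⟩,
    (baseEnergy_le_energyRate net hp tr hσ01).trans_eq ?_⟩
  · simp only [offeredRate, ha]
    rw [Finset.mul_sum]
    exact Finset.sum_congr rfl fun k _ => by ring
  · simp only [objective, Finset.mul_sum]
    rw [Finset.sum_comm]
    refine Finset.sum_congr rfl fun n _ => ?_
    have h : ∀ k, chanProb net k * (p n k true false * st n k true * net.e10 n
        + p n k false true * st n k false * net.e01 n + st n k false * net.e0 n
        + st n k true * (net.c n + tr n k * net.rate n k * net.α n))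
        = chanProb net k * (σ n * net.c n + (1 - σ n) * net.e0 n)
          + chanProb net k * tr n k * net.rate n k * (σ n * net.α n)
          + chanProb net k * p n k true false * (σ n * net.e10 n)
          + chanProb net k * p n k false true * ((1 - σ n) * net.e01 n) := fun k => by
      linear_combination (p n k true false * net.e10 n + net.c n
        + tr n k * net.rate n k * net.α n) * ha n k
        + (p n k false true * net.e01 n + net.e0 n) * hb n k
    simp_rw [h]
    simp only [Finset.sum_add_distrib, ← Finset.sum_mul, sum_chanProb, offeredRate, meanSwitch]
    ring

/-- With frozen modes (`κ = 0`) every `σ` is stationary and switching costs nothing. -/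
theorem IsStatic.baseEnergy_mem_feasibleValues {net : Network N K} {lam : Fin N → ℝ}
    {x : (Fin N → ℝ) × (Fin N → K → ℝ)} (hx : IsStatic net lam x) :
    baseEnergy net x ∈ feasibleValues net lam := by
  obtain ⟨σ, tr⟩ := x
  obtain ⟨hσ, htr, hs⟩ := hx
  refine ⟨lazySwitch K 0 σ, fun n _ l => if l then σ n else 1 - σ n, tr,
    ⟨isSwitching_lazySwitch le_rfl zero_le_one hσ, ⟨fun n k l => ?_, fun n k => by simp,
      fun n k l => ?_⟩, htr, fun n => (hs n).trans_eq ?_⟩, ?_⟩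
  · cases l
    · simpa using (hσ n).2
    · simpa using (hσ n).1
  · cases l <;> simp only [lazySwitch, Fintype.sum_bool] <;> simp <;>
      simp only [← Finset.sum_mul, sum_chanProb] <;> ring
  · simp only [offeredRate, if_true]
    rw [Finset.mul_sum]
    exact Finset.sum_congr rfl fun k _ => by ring
  · simp only [objective, baseEnergy, offeredRate, Finset.mul_sum]
    rw [Finset.sum_comm]
    refine Finset.sum_congr rfl fun n _ => ?_
    have h : ∀ k, chanProb net k * (0 * (1 - σ n) * (if true = true then σ n else 1 - σ n)
        * net.e10 n + 0 * σ n * (if false = true then σ n else 1 - σ n) * net.e01 n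
        + (if false = true then σ n else 1 - σ n) * net.e0 n
        + (if true = true then σ n else 1 - σ n)
          * (net.c n + tr n k * net.rate n k * net.α n))
        = chanProb net k * (σ n * net.c n + (1 - σ n) * net.e0 n)
          + σ n * (chanProb net k * tr n k * net.rate n k) * net.α n := fun k => by
      simp only [if_true, Bool.false_eq_true, if_false]
      ring
    refine (Finset.sum_congr rfl fun k _ => h k).trans ?_
    simp only [Finset.sum_add_distrib, ← Finset.sum_mul, sum_chanProb]
    ring

/-- With slack in the offered rates, the minimum energy is the least energy of a static point. -/
theorem exists_minimizer {net : Network N K} {A : Arrival N} {tr : Fin N → K → ℝ}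
    (htr : IsTransmission tr) {γ : ℝ} (hγ : 0 < γ)
    (hs : ∀ n, A.mean n + γ ≤ offeredRate net tr n) :
    ∃ x, IsStatic net A.mean x ∧
      (∀ y, IsStatic net A.mean y → baseEnergy net x ≤ baseEnergy net y) ∧
      IsGLB (stabilizingEnergies net A) (baseEnergy net x) ∧
      minEnergy net A = baseEnergy net x := by
  have h₀ : IsStatic net A.mean ((fun _ => 1), tr) :=
    ⟨fun n => ⟨zero_le_one, le_rfl⟩, htr, fun n => by
      dsimp only
      linarith [hs n]⟩
  obtain ⟨x, hx, hmin⟩ := exists_baseEnergy_minimizer net h₀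
  have key : ∀ η : ℝ, 0 < η → ∃ h ∈ stabilizingEnergies net A, h < baseEnergy net x + η := by
    intro η hη
    obtain ⟨γ', hγ', y, hy, hyx⟩ := hx.exists_slack A.mean_nonneg htr hγ hs (half_pos hη)
    obtain ⟨h, hh, hlt⟩ := hy.exists_stabilizing hγ' (half_pos hη)
    exact ⟨h, hh, by linarith⟩
  have hglb : IsGLB (stabilizingEnergies net A) (baseEnergy net x) := by
    refine ⟨fun h hh => ?_, fun b hb => le_of_forall_pos_le_add fun η hη => ?_⟩
    · obtain ⟨y, hy, hle⟩ := exists_isStatic_of_mem_stabilizingEnergies hh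
      exact (hmin y hy).trans hle
    · obtain ⟨h, hh, hlt⟩ := key η hη
      exact (hb hh).trans hlt.le
  obtain ⟨h, hh, -⟩ := key 1 one_pos
  exact ⟨x, hx, hmin, hglb, hglb.csInf_eq ⟨h, hh⟩⟩

end StaticProblem

end SensorNet

/-! ### Assembly of the theorem. -/

theorem theorem1 {N : ℕ} {K : Type} [Fintype K] [MeasurableSpace K] [MeasurableSingletonClass K]
    (net : SensorNet.Network N K) (A : SensorNet.Arrival N)
    (hA : ∃ δ : ℝ, 0 < δ ∧ (fun n => A.mean n + δ) ∈ SensorNet.capacityRegion net) :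
    IsGLB (SensorNet.stabilizingEnergies net A) (SensorNet.minEnergy net A) ∧
    IsLeast (SensorNet.feasibleValues net A.mean) (SensorNet.minEnergy net A) ∧
    ∀ η : ℝ, 0 < η → ∃ δ : ℝ, 0 < δ ∧
      ∀ (ε : Fin N → ℝ) (B : SensorNet.Arrival N), (∀ n, 0 ≤ ε n ∧ ε n < δ) →
        (∀ n, B.mean n = A.mean n + ε n) →
        |SensorNet.minEnergy net B - SensorNet.minEnergy net A| < η := by
  obtain ⟨δ₀, hδ₀, hcap⟩ := hA
  obtain ⟨tr, htr, γ, hγ, hs⟩ := SensorNet.exists_offeredRate_gt hδ₀ hcap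
  obtain ⟨x, hx, hmin, hglb, heq⟩ := SensorNet.exists_minimizer htr hγ hs
  rw [heq]
  refine ⟨hglb, ⟨hx.baseEnergy_mem_feasibleValues, fun v hv => ?_⟩, fun η hη => ?_⟩
  · obtain ⟨y, hy, hle⟩ := SensorNet.exists_isStatic_of_mem_feasibleValues hv
    exact (hmin y hy).trans hle
  · obtain ⟨γ', hγ', y, hy, hyx⟩ := hx.exists_slack A.mean_nonneg htr hγ hs hη
    -- Below `γ'` the cheap perturbed point `y` still covers the larger arrivals; below `γ / 2`
    -- enough slack remains for `minEnergy net B` to be a static minimum.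
    refine ⟨min γ' (γ / 2), lt_min hγ' (half_pos hγ), fun ε B hε hB => ?_⟩
    have hsB : ∀ n, B.mean n + γ / 2 ≤ SensorNet.offeredRate net tr n := fun n => by
      have h1 := (hε n).2.trans_le (min_le_right _ _)
      rw [hB]
      linarith [hs n]
    obtain ⟨z, hz, hminz, -, hzeq⟩ := SensorNet.exists_minimizer htr (half_pos hγ) hsB
    have h1 : SensorNet.baseEnergy net z ≤ SensorNet.baseEnergy net y :=
      hminz y (hy.anti fun n => by
        rw [hB]
        linarith [(hε n).2.trans_le (min_le_left _ _)])
    -- Larger arrival rates only shrink the static feasible set, so the energy cannot decrease.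
    have h2 : SensorNet.baseEnergy net x ≤ SensorNet.baseEnergy net z :=
      hmin z (hz.anti fun n => by
        rw [hB]
        linarith [(hε n).1])
    rw [hzeq, abs_lt]
    constructor <;> linarith
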